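/- **Setting.** Let $\bar s\ge 0$ (storage capacity), $r>0$ (ramp rate), $Q>0$ (arrival rate), $\theta>0$ (discount rate), $B\in\mathbb R$, and let $f_W$ be a probability law on $\mathbb R$ supported in $[0,B]$. Let $g:[0,B]\to\mathbb R$ be bounded, strictly increasing and continuously differentiable with $g(0)=0$ and $\mathbf E[g(W)]>0$ for $W\sim f_W$. Shocks arrive at the times $t_1<t_2<\cdots$ of a Poisson process of rate $Q$, and have i.i.d. sizes $W_1,W_2,\dots\sim f_W$ independent of the arrival times. A (stationary Markov) policy is a measurable function $\mu$ with $0\le\mu(s,w)\le\min\{s,w\}$ for $(s,w)\in[0,\bar s]\times[0,B]$; $\Pi$ is the set of policies. Under $\mu$ the storage level $s_t$ increases at rate $r$ while it is below $\bar s$, stays at $\bar s$ once full, and drops by $\mu(s_{t_k^-},W_k)$ at time $t_k$. For $(s,w)\in[0,\bar s]\times[0,B]$ let $$C_\mu(s)=\mathbf E\Big[\sum_{k\ge1}e^{-\theta t_k}g\big(W_k-\mu(s_{t_k^-},W_k)\big)\,\Big|\,s_0=s\Big],\qquad J_\mu(s,w)=g(w-\mu(s,w))+C_\mu(s-\mu(s,w)),$$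 so $J_\mu(s,w)$ is the expected discounted cost given that a first additional shock of size $w$ occurs at time $0$ at level $s$. For a function $J$ on $[0,\bar s]\times[0,B]$ let $$(TJ)(s,w)=\min_{u\in[0,\min\{s,w\}]}\Big\{g(w-u)+\mathbf E\big[e^{-\theta t_0}J(\min\{s-u+rt_0,\bar s\},W)\big]\Big\},$$ where $t_0$ is exponential with mean $1/Q$ and independent of $W\sim f_W$. Call $J$ *regular* if $e^{-\theta t_0}J(\min\{x+rt_0,\bar s\},W)$ is integrable for every $x\in[0,\bar s]$, so that these expectations exist; every bounded measurable $J$ is regular. **Theorem.** 1. For every $\mu\in\Pi$ and $s\in[0,\bar s]$ the sum defining $C_\mu(s)$ converges almost surely and is integrable, and for every $(s,w)\in[0,\bar s]\times[0,B]$ the minimum $J^*(s,w)=\min_{\mu\in\Pi}J_\mu(s,w)$ is attained. If $J$ is regular, the minimum defining $(TJ)(s,w)$ is attained for every $(s,w)\in[0,\bar s]\times[0,B]$, and $TJ$ is regular. 2. A function $J:[0,\bar s]\times[0,B]\to\mathbb R$ equals $J^*$ if and only if it is regular and satisfies $J=TJ$. 3. A policy $\mu^*$ is optimal for the conditional cost,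 i.e. $J_{\mu^*}(s,w)=\min_{\mu\in\Pi}J_\mu(s,w)$ for all $(s,w)\in[0,\bar s]\times[0,B]$, if and only if for all such $(s,w)$ the value $u=\mu^*(s,w)$ achieves the minimum in $(TJ^*)(s,w)$. It is optimal for the unconditional cost, i.e. $C_{\mu^*}(s)=\min_{\mu\in\Pi}C_\mu(s)$ for all $s\in[0,\bar s]$, if and only if $u=\mu^*(s,w)$ achieves that minimum for almost every $(s,w)$ with respect to the law of $(\min\{rt_0,\bar s\},W)$. 4. For every regular $J_0$, the value iteration $J_{k+1}=TJ_k$ converges to $J^*$, uniformly on $[0,\bar s]\times[0,B]$. -/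

import Mathlib

open Set Filter Topology MeasureTheory ProbabilityTheory

noncomputable section

/-- The data of the storage control problem: capacity `cap`, ramp rate `r`, arrival rate `Q` of the
shocks, discount rate `θ`, bound `B` on the shock sizes, law `ν` of a shock size, and stage cost `g`
(of which only the values on `[0, B]` matter). -/
structure StorageModel where
  cap : ℝ
  r : ℝ
  Q : ℝ
  θ : ℝ
  B : ℝ
  ν : Measure ℝ
  g : ℝ → ℝ

namespace StorageModel

/-- The standing assumptions. -/
structure Assumptions (m : StorageModel) : Prop where
  cap_nonneg : 0 ≤ m.cap
  r_pos : 0 < m.r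
  Q_pos : 0 < m.Q
  θ_pos : 0 < m.θ
  isProbabilityMeasure : IsProbabilityMeasure m.ν
  shock_mem : ∀ᵐ w ∂m.ν, w ∈ Icc 0 m.B
  g_bounded : ∃ M : ℝ, ∀ x ∈ Icc 0 m.B, |m.g x| ≤ M
  g_strictMono : StrictMonoOn m.g (Icc 0 m.B)
  g_contDiff : ContDiffOn ℝ 1 m.g (Icc 0 m.B)
  g_zero : m.g 0 = 0
  g_mean_pos : 0 < ∫ w, m.g w ∂m.ν

/-- A feasible stationary Markov policy: from storage level `s`, a shock of size `w` is answered by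
withdrawing `μ s w ∈ [0, min {s, w}]`. -/
def IsPolicy (m : StorageModel) (μ : ℝ → ℝ → ℝ) : Prop :=
  Measurable (Function.uncurry μ) ∧
    ∀ s ∈ Icc 0 m.cap, ∀ w ∈ Icc 0 m.B, μ s w ∈ Icc 0 (min s w)

/-- The storage level after a shock-free period of length `t` that starts at level `x`: storage
fills at rate `r` until it is full. -/
def fill (m : StorageModel) (x t : ℝ) : ℝ := min (x + m.r * t) m.cap

/-- `fill` solves the storage dynamics `ds = 1_{s < cap} r dt` between shocks. -/
theorem fill_eq_integral (m : StorageModel) (hr : 0 < m.r) {x t : ℝ} (hx : x ≤ m.cap)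
    (ht : 0 ≤ t) :
    m.fill x t = x + ∫ v in (0 : ℝ)..t, {v | m.fill x v < m.cap}.indicator (fun _ => m.r) v := by
  have hset : {v | m.fill x v < m.cap} = Iio ((m.cap - x) / m.r) := by
    ext v
    simp only [fill, mem_ofPred_eq, mem_Iio, min_lt_iff, lt_irrefl, or_false, lt_div_iff₀ hr]
    constructor <;> intro h <;> linarith
  have h0 : 0 ≤ (m.cap - x) / m.r := div_nonneg (by linarith) hr.le
  rw [hset, intervalIntegral.integral_of_le ht, setIntegral_indicator measurableSet_Iio,
    setIntegral_const, smul_eq_mul, measureReal_def]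
  have hI : volume (Ioc 0 t ∩ Iio ((m.cap - x) / m.r))
      = ENNReal.ofReal (min t ((m.cap - x) / m.r)) := by
    rcases lt_or_ge t ((m.cap - x) / m.r) with h | h
    · have : Ioc 0 t ∩ Iio ((m.cap - x) / m.r) = Ioc 0 t := by
        ext v; simp only [mem_inter_iff, mem_Ioc, mem_Iio]; constructor
        · exact fun hv => hv.1
        · exact fun hv => ⟨hv, hv.2.trans_lt h⟩
      rw [this, Real.volume_Ioc, min_eq_left h.le, sub_zero]
    · have : Ioc 0 t ∩ Iio ((m.cap - x) / m.r) = Ioo 0 ((m.cap - x) / m.r) := by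
        ext v; simp only [mem_inter_iff, mem_Ioc, mem_Iio, mem_Ioo]; constructor
        · exact fun hv => ⟨hv.1.1, hv.2⟩
        · exact fun hv => ⟨⟨hv.1, hv.2.le.trans h⟩, hv.2⟩
      rw [this, Real.volume_Ioo, min_eq_right h, sub_zero]
  rw [hI, ENNReal.toReal_ofReal (le_min ht h0), fill, min_mul_of_nonneg _ _ hr.le,
    div_mul_cancel₀ _ hr.ne', ← min_add_add_left]
  congr 1 <;> ring

/-- The joint law of an exponential time `t₀` of rate `Q` and an independent shock size `W`. -/
def stepLaw (m : StorageModel) : Measure (ℝ × ℝ) := (expMeasure m.Q).prod m.ν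

section ShockModel

variable {Ω : Type*} [MeasurableSpace Ω]

/-- `τ k` are the interarrival times and `W k` the shock sizes of a compound Poisson process of rate
`Q` and jump law `ν`: all of them are independent, `τ k` is exponential with rate `Q`, and `W k`
has law `ν`. (Arrivals are numbered from `0` here.) -/
structure IsCompoundPoisson (m : StorageModel) (P : Measure Ω) (τ W : ℕ → Ω → ℝ) : Prop where
  measurable_time : ∀ k, Measurable (τ k)
  measurable_size : ∀ k, Measurable (W k)
  indep : iIndepFun (fun k ω => (τ k ω, W k ω)) P
  law : ∀ k, P.map (fun ω => (τ k ω, W k ω)) = m.stepLaw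

/-- The time of the `k`-th arrival. -/
def arrivalTime (τ : ℕ → Ω → ℝ) (k : ℕ) (ω : Ω) : ℝ := ∑ i ∈ Finset.range (k + 1), τ i ω

/-- The storage level just before the `k`-th arrival, starting from level `s` at time `0` and
following the policy `μ`. -/
def levelBefore (m : StorageModel) (τ W : ℕ → Ω → ℝ) (μ : ℝ → ℝ → ℝ) (s : ℝ) : ℕ → Ω → ℝ
  | 0, ω => m.fill s (τ 0 ω)
  | k + 1, ω =>
      m.fill (levelBefore m τ W μ s k ω - μ (levelBefore m τ W μ s k ω) (W k ω)) (τ (k + 1) ω)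

/-- The discounted cost of the `k`-th shock. -/
def discountedStageCost (m : StorageModel) (τ W : ℕ → Ω → ℝ) (μ : ℝ → ℝ → ℝ) (s : ℝ)
    (k : ℕ) (ω : Ω) : ℝ :=
  Real.exp (-m.θ * arrivalTime τ k ω) *
    m.g (W k ω - μ (m.levelBefore τ W μ s k ω) (W k ω))

/-- `C_μ(s)`: the expected total discounted cost of the policy `μ` from the initial level `s`. -/
def cost (m : StorageModel) (P : Measure Ω) (τ W : ℕ → Ω → ℝ) (μ : ℝ → ℝ → ℝ) (s : ℝ) : ℝ :=
  ∫ ω, ∑' k, m.discountedStageCost τ W μ s k ω ∂P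

/-- `J_μ(s, w)`: the expected total discounted cost of `μ` when an additional first shock, of size
`w`, occurs at time `0` at storage level `s`. -/
def condCost (m : StorageModel) (P : Measure Ω) (τ W : ℕ → Ω → ℝ) (μ : ℝ → ℝ → ℝ)
    (s w : ℝ) : ℝ :=
  m.g (w - μ s w) + m.cost P τ W μ (s - μ s w)

/-- The values `J_μ(s, w)` over all feasible policies `μ`. -/
def condCostValues (m : StorageModel) (P : Measure Ω) (τ W : ℕ → Ω → ℝ) (s w : ℝ) : Set ℝ :=
  {c | ∃ μ, m.IsPolicy μ ∧ c = m.condCost P τ W μ s w}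

/-- The optimal conditional cost `J*(s, w)`. -/
def optCondCost (m : StorageModel) (P : Measure Ω) (τ W : ℕ → Ω → ℝ) (s w : ℝ) : ℝ :=
  sInf (m.condCostValues P τ W s w)

end ShockModel

/-- The expectations in the Bellman operator exist for `J`; every bounded measurable `J` on
`[0, cap] × [0, B]` has this property. -/
def HasExpectations (m : StorageModel) (J : ℝ → ℝ → ℝ) : Prop :=
  ∀ x ∈ Icc 0 m.cap,
    Integrable (fun p : ℝ × ℝ => Real.exp (-m.θ * p.1) * J (m.fill x p.1) p.2) m.stepLaw

/-- The function of `u` that the Bellman operator minimizes: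
`g(w - u) + E[exp(-θ t₀) J(min {s - u + r t₀, cap}, W)]`. -/
def bellmanObjective (m : StorageModel) (J : ℝ → ℝ → ℝ) (s w u : ℝ) : ℝ :=
  m.g (w - u) + ∫ p : ℝ × ℝ, Real.exp (-m.θ * p.1) * J (m.fill (s - u) p.1) p.2 ∂m.stepLaw

/-- The Bellman operator `T`. -/
def bellman (m : StorageModel) (J : ℝ → ℝ → ℝ) (s w : ℝ) : ℝ :=
  sInf (m.bellmanObjective J s w '' Icc 0 (min s w))

end StorageModel

end

/-! Two facts carry the theorem. The first is regularization by the exponential arrival time.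
Starting at level `x` amounts to starting empty `x / r` time units earlier (`fill_shift`), so by
memorylessness `stepValue J x` equals `exp ((Q + θ) * (x / r))` times the integral of one fixed
integrable function over the times after `x / r`. This is continuous in `x` even when `J` is not
(`continuousOn_stepValue`). Hence `T` maps every regular `J` to a function that is continuous, and
so bounded, on the compact rectangle (`exists_bellmanClamp`). On bounded continuous functions `T`
contracts with modulus `E[exp(-θ t₀)] < 1`. Banach's theorem gives a fixed point `V`, its uniqueness
among regular functions, and uniform convergence of value iteration, since after one step every
iterate is continuous and bounded.

The second is a verification identity. The defect of a policy at `(s, w)` is the loss from using the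
policy for this shock and collecting `V` afterwards. It is nonnegative, and it vanishes exactly when
the policy attains the Bellman minimum. The Markov property makes the expected discounted values of
`V` telescope, so `C_μ(s) - stepValue V s` is the sum over `k` of the expected discounted defects
(`tendsto_sum_bellmanDefect`). A measurable choice of minimizers makes every defect zero, so `V =
J*`. Conditional optimality forces zero defect at every point. Unconditional optimality forces it
only almost everywhere for the law of the state at the first shock from empty storage; this suffices
because the laws from other levels are absolutely continuous with respect to that one. -/

/-! ### The exponential law under translation. -/

/-- Memorylessness: the exponential law shifted by `a ≥ 0` is its conditional law on `[a, ∞)`. -/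
theorem map_add_expMeasure (Q : ℝ) {a : ℝ} (ha : 0 ≤ a) :
    (expMeasure Q).map (a + ·) =
      ENNReal.ofReal (Real.exp (Q * a)) • (expMeasure Q).restrict (Ici a) := by
  ext A hA
  have hpdf : ∀ t, exponentialPDF Q (t - a) =
      ENNReal.ofReal (Real.exp (Q * a)) * (Ici a).indicator (exponentialPDF Q) t := by
    intro t
    by_cases h : a ≤ t
    · rw [indicator_of_mem (mem_Ici.2 h), exponentialPDF_of_nonneg (sub_nonneg.2 h),
        exponentialPDF_of_nonneg (ha.trans h), ← ENNReal.ofReal_mul (Real.exp_pos _).le]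
      congr 1
      rw [mul_left_comm, ← Real.exp_add]
      ring_nf
    · rw [indicator_of_notMem (by simpa using h), mul_zero,
        exponentialPDF_of_neg (by linarith)]
  have hmeas : Measurable (exponentialPDF Q) := (measurable_exponentialPDFReal Q).ennreal_ofReal
  have hdef : expMeasure Q = volume.withDensity (exponentialPDF Q) := rfl
  rw [Measure.map_apply (by fun_prop) hA, Measure.smul_apply, Measure.restrict_apply hA, hdef,
    withDensity_apply _ (hA.preimage (by fun_prop)),
    withDensity_apply _ (hA.inter measurableSet_Ici), smul_eq_mul,
    ← lintegral_const_mul _ hmeas, ← lintegral_indicator (hA.preimage (by fun_prop)),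
    ← lintegral_indicator (hA.inter measurableSet_Ici),
    ← lintegral_sub_right_eq_self (μ := volume) _ a]
  congr 1 with t
  by_cases h : t ∈ A
  · have h' : t - a ∈ (fun x => a + x) ⁻¹' A := by simpa using h
    rw [indicator_of_mem h', hpdf]
    by_cases h2 : t ∈ Ici a
    · rw [indicator_of_mem h2, indicator_of_mem (mem_inter h h2)]
    · rw [indicator_of_notMem h2, indicator_of_notMem (fun h3 => h2 h3.2), mul_zero]
  · have h' : t - a ∉ (fun x => a + x) ⁻¹' A := by simpa using h
    rw [indicator_of_notMem h', indicator_of_notMem (fun h3 => h h3.1)]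

theorem ae_expMeasure_ne (Q a : ℝ) : ∀ᵐ t ∂expMeasure Q, t ≠ a := by
  have hac : expMeasure Q ≪ volume := withDensity_absolutelyContinuous _ (exponentialPDF Q)
  exact hac.ae_le (Measure.ae_ne volume a)

theorem ae_expMeasure_pos (Q : ℝ) : ∀ᵐ t ∂expMeasure Q, 0 < t := by
  have hdef : expMeasure Q = volume.withDensity (exponentialPDF Q) := rfl
  have h0 : ∀ᵐ t ∂expMeasure Q, 0 ≤ t := by
    rw [ae_iff]
    have hset : {t : ℝ | ¬ 0 ≤ t} = Iio 0 := by ext; simp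
    rw [hset, hdef, withDensity_apply _ measurableSet_Iio]
    exact lintegral_exponentialPDF_of_nonpos le_rfl
  have h1 : ∀ᵐ t ∂expMeasure Q, t ≠ 0 := ae_expMeasure_ne Q 0
  filter_upwards [h0, h1] with t h h' using lt_of_le_of_ne h (Ne.symm h')

/-! ### One-step expectations and their dependence on the initial level. -/

noncomputable section

namespace StorageModel

variable {m : StorageModel}

/-- The expected discounted value of `J` at the first shock, starting from level `x`. -/
def stepValue (m : StorageModel) (J : ℝ → ℝ → ℝ) (x : ℝ) : ℝ :=
  ∫ p : ℝ × ℝ, Real.exp (-m.θ * p.1) * J (m.fill x p.1) p.2 ∂m.stepLaw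

theorem Assumptions.isProbabilityMeasure_stepLaw (hm : m.Assumptions) :
    IsProbabilityMeasure m.stepLaw := by
  have := hm.isProbabilityMeasure
  have := isProbabilityMeasure_expMeasure hm.Q_pos
  unfold stepLaw
  infer_instance

theorem Assumptions.ae_stepLaw (hm : m.Assumptions) :
    ∀ᵐ p ∂m.stepLaw, 0 < p.1 ∧ p.2 ∈ Icc 0 m.B := by
  have := hm.isProbabilityMeasure
  have := isProbabilityMeasure_expMeasure hm.Q_pos
  have h1 : ∀ᵐ p ∂m.stepLaw, 0 < p.1 :=
    Measure.quasiMeasurePreserving_fst.ae (ae_expMeasure_pos m.Q)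
  have h2 : ∀ᵐ p ∂m.stepLaw, p.2 ∈ Icc 0 m.B :=
    Measure.quasiMeasurePreserving_snd.ae hm.shock_mem
  exact h1.and h2

theorem Assumptions.fill_mem (hm : m.Assumptions) {x t : ℝ} (hx : 0 ≤ x) (ht : 0 ≤ t) :
    m.fill x t ∈ Icc 0 m.cap :=
  ⟨le_min (add_nonneg hx (mul_nonneg hm.r_pos.le ht)) hm.cap_nonneg, min_le_right _ _⟩

theorem measurable_fill (m : StorageModel) : Measurable fun p : ℝ × ℝ => m.fill p.1 p.2 := by
  unfold fill
  fun_prop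

theorem Assumptions.B_nonneg (hm : m.Assumptions) : 0 ≤ m.B := by
  have := hm.isProbabilityMeasure
  obtain ⟨w, hw⟩ := hm.shock_mem.exists
  exact hw.1.trans hw.2

theorem Assumptions.discount_le_one (hm : m.Assumptions) {t : ℝ} (ht : 0 ≤ t) :
    Real.exp (-m.θ * t) ≤ 1 :=
  Real.exp_le_one_iff.2 (by nlinarith [hm.θ_pos])

theorem fill_shift (m : StorageModel) (hr : 0 < m.r) (x t : ℝ) :
    m.fill x t = m.fill 0 (x / m.r + t) := by
  unfold fill
  congr 1
  field_simp
  ring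

/-- A change of variables along a measurable embedding needs no measurability of the integrand, and
a regular `J` need not be measurable. -/
theorem measurableEmbedding_shift (a : ℝ) :
    MeasurableEmbedding (Prod.map (a + ·) id : ℝ × ℝ → ℝ × ℝ) :=
  ((MeasurableEquiv.addLeft a).prodCongr (MeasurableEquiv.refl ℝ)).measurableEmbedding

theorem Assumptions.map_shift_stepLaw (hm : m.Assumptions) {a : ℝ} (ha : 0 ≤ a) :
    m.stepLaw.map (Prod.map (a + ·) id) =
      ENNReal.ofReal (Real.exp (m.Q * a)) • m.stepLaw.restrict (Ici a ×ˢ univ) := by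
  have := hm.isProbabilityMeasure
  have := isProbabilityMeasure_expMeasure hm.Q_pos
  unfold stepLaw
  rw [← Measure.map_prod_map _ _ (by fun_prop) measurable_id, map_add_expMeasure _ ha,
    Measure.map_id, Measure.prod_smul_left, ← Measure.prod_restrict, Measure.restrict_univ]

/-- The state at the first shock from level `x` is the one from empty storage after a time shift by
`x / r`, and the shifted law is absolutely continuous. Null sets for the start at `0` are therefore
null for every start. -/
theorem Assumptions.ae_stepLaw_fill (hm : m.Assumptions) {q : ℝ → ℝ → Prop} {x : ℝ} (hx : 0 ≤ x)
    (h : ∀ᵐ p ∂m.stepLaw, q (m.fill 0 p.1) p.2) :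
    ∀ᵐ p ∂m.stepLaw, q (m.fill x p.1) p.2 := by
  have hac : m.stepLaw.map (Prod.map (x / m.r + ·) id) ≪ m.stepLaw := by
    rw [hm.map_shift_stepLaw (div_nonneg hx hm.r_pos.le)]
    exact (Measure.smul_absolutelyContinuous).trans Measure.restrict_le_self.absolutelyContinuous
  have h2 : ∀ᵐ p ∂_, _ := hac.ae_le h
  rw [(measurableEmbedding_shift _).ae_map_iff] at h2
  filter_upwards [h2] with p hp
  rw [fill_shift m hm.r_pos]
  exact hp

/-- The step value from level `x` as an integral over the shocks after time `x / r` that start from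
an empty storage. -/
theorem Assumptions.stepValue_eq (hm : m.Assumptions) (J : ℝ → ℝ → ℝ) {x : ℝ} (hx : 0 ≤ x) :
    m.stepValue J x = Real.exp ((m.Q + m.θ) * (x / m.r)) *
      ∫ p, (Ici (x / m.r) ×ˢ univ).indicator
        (fun p : ℝ × ℝ => Real.exp (-m.θ * p.1) * J (m.fill 0 p.1) p.2) p ∂m.stepLaw := by
  have ha : 0 ≤ x / m.r := div_nonneg hx hm.r_pos.le
  -- The constant `exp (θ * (x / r))` undoes the discounting over the fictitious filling time `x /
  -- r`; memorylessness contributes the factor `exp (Q * (x / r))`.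
  have h1 := (measurableEmbedding_shift (x / m.r)).integral_map (μ := m.stepLaw)
    (fun p : ℝ × ℝ => Real.exp (m.θ * (x / m.r)) *
      (Real.exp (-m.θ * p.1) * J (m.fill 0 p.1) p.2))
  rw [hm.map_shift_stepLaw ha, integral_smul_measure,
    ENNReal.toReal_ofReal (Real.exp_pos _).le, integral_const_mul,
    ← integral_indicator (measurableSet_Ici.prod MeasurableSet.univ)] at h1
  have h2 : m.stepValue J x = ∫ p : ℝ × ℝ, Real.exp (m.θ * (x / m.r)) *
      (Real.exp (-m.θ * (x / m.r + p.1)) * J (m.fill 0 (x / m.r + p.1)) p.2) ∂m.stepLaw := by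
    unfold stepValue
    congr 1 with p
    rw [fill_shift m hm.r_pos x, ← mul_assoc, ← Real.exp_add]
    congr 2
    ring
  rw [h2, add_mul, Real.exp_add, mul_assoc]
  exact h1.symm

/-- Only the domain of integration depends on the level, so continuity comes from the law of the
arrival time and not from `J`. Integrability at level `0` provides the dominating function. -/
theorem Assumptions.continuousOn_stepValue (hm : m.Assumptions) {J : ℝ → ℝ → ℝ}
    (hJ : m.HasExpectations J) : ContinuousOn (m.stepValue J) (Icc 0 m.cap) := by
  have := hm.isProbabilityMeasure
  have := isProbabilityMeasure_expMeasure hm.Q_pos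
  have hint := hJ 0 ⟨le_rfl, hm.cap_nonneg⟩
  set G : ℝ × ℝ → ℝ := fun p => Real.exp (-m.θ * p.1) * J (m.fill 0 p.1) p.2 with hG
  have hc : Continuous fun a : ℝ => ∫ p, (Ici a ×ˢ univ).indicator G p ∂m.stepLaw := by
    rw [continuous_iff_continuousAt]
    intro a
    refine continuousAt_of_dominated (bound := fun p => ‖G p‖) ?_ ?_ hint.norm ?_
    · exact .of_forall fun b => hint.aestronglyMeasurable.indicator
        (measurableSet_Ici.prod MeasurableSet.univ)
    · exact .of_forall fun b => .of_forall fun p => norm_indicator_le_norm_self _ _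
    -- The indicator of `[b, ∞)` is locally constant in `b` near `a` except at time `a`, which has
    -- probability zero.
    · have hne : ∀ᵐ p ∂m.stepLaw, p.1 ≠ a :=
        Measure.quasiMeasurePreserving_fst.ae (ae_expMeasure_ne m.Q a)
      filter_upwards [hne] with p hp
      rcases lt_or_gt_of_ne hp with h | h
      · refine (continuousAt_const (y := (0 : ℝ))).congr ?_
        filter_upwards [lt_mem_nhds h] with b hb
        rw [indicator_of_notMem]
        simpa using hb
      · refine (continuousAt_const (y := G p)).congr ?_
        filter_upwards [gt_mem_nhds h] with b hb
        rw [indicator_of_mem]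
        simpa using hb.le
  have hc2 : Continuous fun x : ℝ => Real.exp ((m.Q + m.θ) * (x / m.r)) *
      ∫ p, (Ici (x / m.r) ×ˢ univ).indicator G p ∂m.stepLaw :=
    Continuous.mul (by fun_prop) (hc.comp (by fun_prop : Continuous fun x : ℝ => x / m.r))
  exact hc2.continuousOn.congr fun x hx => hm.stepValue_eq J hx.1

theorem Assumptions.stepValue_eq_zero (hm : m.Assumptions) {f : ℝ → ℝ → ℝ} {x : ℝ} (hx : 0 ≤ x)
    (h : ∀ᵐ p ∂m.stepLaw, f (m.fill 0 p.1) p.2 = 0) : m.stepValue f x = 0 := by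
  refine integral_eq_zero_of_ae ?_
  filter_upwards [hm.ae_stepLaw_fill (q := fun s w => f s w = 0) hx h] with p hp
  simp [hp]

theorem Assumptions.step_congr (hm : m.Assumptions) {J J' : ℝ → ℝ → ℝ}
    (h : ∀ s ∈ Icc 0 m.cap, ∀ w ∈ Icc 0 m.B, J s w = J' s w) {x : ℝ} (hx : 0 ≤ x) :
    (fun p : ℝ × ℝ => Real.exp (-m.θ * p.1) * J (m.fill x p.1) p.2) =ᵐ[m.stepLaw]
      fun p : ℝ × ℝ => Real.exp (-m.θ * p.1) * J' (m.fill x p.1) p.2 := by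
  filter_upwards [hm.ae_stepLaw] with p hp
  rw [h _ (hm.fill_mem hx hp.1.le) _ hp.2]

theorem Assumptions.stepValue_congr (hm : m.Assumptions) {J J' : ℝ → ℝ → ℝ}
    (h : ∀ s ∈ Icc 0 m.cap, ∀ w ∈ Icc 0 m.B, J s w = J' s w) {x : ℝ} (hx : 0 ≤ x) :
    m.stepValue J x = m.stepValue J' x :=
  integral_congr_ae (hm.step_congr h hx)

theorem Assumptions.hasExpectations_congr (hm : m.Assumptions) {J J' : ℝ → ℝ → ℝ}
    (h : ∀ s ∈ Icc 0 m.cap, ∀ w ∈ Icc 0 m.B, J s w = J' s w) (hJ : m.HasExpectations J) :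
    m.HasExpectations J' :=
  fun x hx => (hJ x hx).congr (hm.step_congr h hx.1)

theorem measurable_step (m : StorageModel) {f : ℝ → ℝ → ℝ} (hf : Measurable (Function.uncurry f)) :
    Measurable fun q : ℝ × (ℝ × ℝ) =>
      Real.exp (-m.θ * q.2.1) * f (m.fill q.1 q.2.1) q.2.2 := by
  refine Measurable.mul (by fun_prop) (hf.comp (Measurable.prodMk ?_ (by fun_prop)))
  exact m.measurable_fill.comp (Measurable.prodMk (by fun_prop) (by fun_prop))

theorem Assumptions.integrable_step (hm : m.Assumptions) {f : ℝ → ℝ → ℝ}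
    (hf : Measurable (Function.uncurry f)) {C : ℝ} (hC : ∀ s w, |f s w| ≤ C) (x : ℝ) :
    Integrable (fun p : ℝ × ℝ => Real.exp (-m.θ * p.1) * f (m.fill x p.1) p.2) m.stepLaw := by
  have := hm.isProbabilityMeasure_stepLaw
  refine Integrable.of_bound (C := C) ((m.measurable_step hf).comp
    (measurable_const.prodMk measurable_id)).aestronglyMeasurable ?_
  filter_upwards [hm.ae_stepLaw] with p hp
  rw [norm_mul, Real.norm_of_nonneg (Real.exp_pos _).le, Real.norm_eq_abs]
  calc _ ≤ 1 * |f (m.fill x p.1) p.2| :=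
        mul_le_mul_of_nonneg_right (hm.discount_le_one hp.1.le) (abs_nonneg _)
    _ ≤ C := by rw [one_mul]; exact hC _ _

theorem Assumptions.hasExpectations_of_bounded (hm : m.Assumptions) {f : ℝ → ℝ → ℝ}
    (hf : Measurable (Function.uncurry f)) {C : ℝ} (hC : ∀ s w, |f s w| ≤ C) :
    m.HasExpectations f :=
  fun x _ => hm.integrable_step hf hC x

/-- The discount factor over one interarrival time. -/
def stepDiscount (m : StorageModel) : ℝ := ∫ p : ℝ × ℝ, Real.exp (-m.θ * p.1) ∂m.stepLaw

theorem Assumptions.integrable_discount (hm : m.Assumptions) :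
    Integrable (fun p : ℝ × ℝ => Real.exp (-m.θ * p.1)) m.stepLaw := by
  simpa using hm.integrable_step (f := fun _ _ => 1) measurable_const (C := 1) (by simp) 0

theorem stepDiscount_nonneg (m : StorageModel) : 0 ≤ m.stepDiscount :=
  integral_nonneg fun _ => (Real.exp_pos _).le

theorem Assumptions.stepDiscount_lt_one (hm : m.Assumptions) : m.stepDiscount < 1 := by
  have := hm.isProbabilityMeasure_stepLaw
  have hi := hm.integrable_discount
  have h1 : 0 < ∫ p : ℝ × ℝ, (1 - Real.exp (-m.θ * p.1)) ∂m.stepLaw := by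
    have hpos : ∀ᵐ p : ℝ × ℝ ∂m.stepLaw, 0 < 1 - Real.exp (-m.θ * p.1) := by
      filter_upwards [hm.ae_stepLaw] with p hp
      have : -m.θ * p.1 < 0 := by nlinarith [mul_pos hm.θ_pos hp.1]
      linarith [Real.exp_lt_exp.2 this, Real.exp_zero]
    rw [integral_pos_iff_support_of_nonneg_ae (hpos.mono fun p hp => hp.le)
      ((integrable_const _).sub hi)]
    have hae : Function.support (fun p : ℝ × ℝ => 1 - Real.exp (-m.θ * p.1)) =ᵐ[m.stepLaw] univ :=
      eventuallyEq_univ.2 (hpos.mono fun p hp => hp.ne')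
    rw [measure_congr hae]
    simp
  rw [integral_sub (integrable_const _) hi] at h1
  simp only [integral_const, probReal_univ, smul_eq_mul, mul_one] at h1
  unfold stepDiscount
  linarith

/-- Monotonicity together with discounting of constants: the one-sided estimate behind the
contraction property. -/
theorem Assumptions.stepValue_le_add (hm : m.Assumptions) {J J' : ℝ → ℝ → ℝ}
    (hJ : m.HasExpectations J) (hJ' : m.HasExpectations J') {D : ℝ}
    (h : ∀ s ∈ Icc 0 m.cap, ∀ w ∈ Icc 0 m.B, J s w ≤ J' s w + D) {x : ℝ}
    (hx : x ∈ Icc 0 m.cap) :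
    m.stepValue J x ≤ m.stepValue J' x + m.stepDiscount * D := by
  unfold stepValue stepDiscount
  rw [← integral_mul_const, ← integral_add (hJ' x hx) (hm.integrable_discount.mul_const _)]
  refine integral_mono_ae (hJ x hx) ((hJ' x hx).add (hm.integrable_discount.mul_const _)) ?_
  filter_upwards [hm.ae_stepLaw] with p hp
  rw [← mul_add]
  exact mul_le_mul_of_nonneg_left (h _ (hm.fill_mem hx.1 hp.1.le) _ hp.2) (Real.exp_pos _).le

end StorageModel

end

/-! ### Minima over intervals depending on a parameter. -/

section ParametricMinimum

variable {X : Type*} [TopologicalSpace X] {F : X → ℝ → ℝ} {b : X → ℝ}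

/-- Rescaling by `b x` replaces the moving interval by the fixed compact interval `[0, 1]`. -/
theorem continuous_sInf_image_Icc (hF : Continuous (Function.uncurry F)) (hb : Continuous b)
    (hb0 : ∀ x, 0 ≤ b x) : Continuous fun x => sInf (F x '' Icc 0 (b x)) := by
  have h : ∀ x, F x '' Icc 0 (b x) = (fun t => F x (b x * t)) '' Icc 0 1 := by
    intro x
    have h1 := image_mul_left_Icc (hb0 x) (zero_le_one' ℝ)
    rw [mul_zero, mul_one] at h1
    rw [← h1, image_image]
  simp_rw [h]
  refine isCompact_Icc.continuous_sInf (f := fun x t => F x (b x * t)) ?_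
  exact hF.comp (continuous_fst.prodMk ((hb.comp continuous_fst).mul continuous_snd))

theorem isLeast_sInf_image_Icc {f : ℝ → ℝ} {c : ℝ} (hc : 0 ≤ c) (hf : ContinuousOn f (Icc 0 c)) :
    IsLeast (f '' Icc 0 c) (sInf (f '' Icc 0 c)) :=
  (isCompact_Icc.image_of_continuousOn hf).isLeast_sInf ((nonempty_Icc.2 hc).image f)

/-- A jointly continuous function has a measurable choice of minimizers over intervals that depend
continuously on the parameter: the smallest minimizer is lower semicontinuous. -/
theorem exists_measurable_minimizer [MeasurableSpace X] [OpensMeasurableSpace X]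
    (hF : Continuous (Function.uncurry F)) (hb : Continuous b) (hb0 : ∀ x, 0 ≤ b x) :
    ∃ u : X → ℝ, Measurable u ∧
      ∀ x, u x ∈ Icc 0 (b x) ∧ F x (u x) = sInf (F x '' Icc 0 (b x)) := by
  have hFx : ∀ x, Continuous (F x) := fun x => hF.comp (continuous_const.prodMk continuous_id)
  set A : X → Set ℝ := fun x => Icc 0 (b x) ∩ F x ⁻¹' {sInf (F x '' Icc 0 (b x))} with hA
  have hcpt : ∀ x, IsCompact (A x) := fun x =>
    isCompact_Icc.inter_right (isClosed_singleton.preimage (hFx x))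
  have hne : ∀ x, (A x).Nonempty := by
    intro x
    obtain ⟨t, ht, hte⟩ := (isLeast_sInf_image_Icc (hb0 x) (hFx x).continuousOn).1
    exact ⟨t, ht, hte⟩
  have hmem : ∀ x, sInf (A x) ∈ A x := fun x => (hcpt x).sInf_mem (hne x)
  refine ⟨fun x => sInf (A x), measurable_of_Iic fun c => ?_, fun x => ⟨(hmem x).1, (hmem x).2⟩⟩
  rcases lt_or_ge c 0 with hc | hc
  · convert! MeasurableSet.empty
    ext x
    simpa using hc.trans_le (hmem x).1.1
  -- The smallest minimizer is at most `c` exactly when truncating the interval at `c` does not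
  -- raise the minimum. Both minima are continuous in `x`, so this is a closed condition.
  · have hset : (fun x => sInf (A x)) ⁻¹' Iic c =
        {x | sInf (F x '' Icc 0 (min (b x) c)) ≤ sInf (F x '' Icc 0 (b x))} := by
      ext x
      have hsub : Icc 0 (min (b x) c) ⊆ Icc 0 (b x) := Icc_subset_Icc_right (min_le_left _ _)
      have hl := isLeast_sInf_image_Icc (le_min (hb0 x) hc) (hFx x).continuousOn
      have hl' := isLeast_sInf_image_Icc (hb0 x) (hFx x).continuousOn
      simp only [mem_preimage, mem_Iic, mem_ofPred_eq]
      constructor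
      · intro h
        have h1 := (hmem x).2
        simp only [mem_preimage, mem_singleton_iff] at h1
        rw [← h1]
        exact hl.2 (mem_image_of_mem _ ⟨(hmem x).1.1, le_min (hmem x).1.2 h⟩)
      · intro h
        obtain ⟨t, ht, hte⟩ := hl.1
        have htA : t ∈ A x := ⟨hsub ht, le_antisymm (hte.le.trans h)
          (hl'.2 (mem_image_of_mem _ (hsub ht)))⟩
        exact (csInf_le (hcpt x).bddBelow htA).trans (ht.2.trans (min_le_right _ _))
    rw [hset]
    exact (isClosed_le
      (continuous_sInf_image_Icc hF (hb.min continuous_const) fun x => le_min (hb0 x) hc)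
      (continuous_sInf_image_Icc hF hb hb0)).measurableSet

end ParametricMinimum

/-! ### The Bellman operator as a contraction. Clamping extends functions from the rectangle to the
plane. -/

/-- The nearest point of `[0, b]`. -/
noncomputable def clamp (b x : ℝ) : ℝ := max 0 (min b x)

theorem clamp_mem {b : ℝ} (hb : 0 ≤ b) (x : ℝ) : clamp b x ∈ Icc 0 b :=
  ⟨le_max_left _ _, max_le hb (min_le_left _ _)⟩

theorem clamp_of_mem {b x : ℝ} (hx : x ∈ Icc 0 b) : clamp b x = x := by
  rw [clamp, min_eq_right hx.2, max_eq_right hx.1]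

theorem continuous_clamp (b : ℝ) : Continuous (clamp b) := by
  unfold clamp
  fun_prop

noncomputable section

open BoundedContinuousFunction

namespace StorageModel

variable {m : StorageModel}

theorem Assumptions.continuous_g_clamp (hm : m.Assumptions) :
    Continuous fun x => m.g (clamp m.B x) :=
  hm.g_contDiff.continuousOn.comp_continuous (continuous_clamp _) (clamp_mem hm.B_nonneg)

/-- The function minimized by the Bellman operator, with its arguments moved into their ranges. -/
def clampedObjective (m : StorageModel) (J : ℝ → ℝ → ℝ) (p : ℝ × ℝ) (u : ℝ) : ℝ :=
  m.g (clamp m.B (clamp m.B p.2 - u)) + m.stepValue J (clamp m.cap (clamp m.cap p.1 - u))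

theorem Assumptions.continuous_clampedObjective (hm : m.Assumptions) {J : ℝ → ℝ → ℝ}
    (hJ : m.HasExpectations J) : Continuous (Function.uncurry (m.clampedObjective J)) := by
  have hc := continuous_clamp m.cap
  have hB := continuous_clamp m.B
  refine Continuous.add ?_ ?_
  · exact hm.continuous_g_clamp.comp (f := fun q : (ℝ × ℝ) × ℝ => clamp m.B q.1.2 - q.2)
      (by fun_prop)
  · exact (hm.continuousOn_stepValue hJ).comp_continuous
      (f := fun q : (ℝ × ℝ) × ℝ => clamp m.cap (clamp m.cap q.1.1 - q.2)) (by fun_prop)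
      (fun q => clamp_mem hm.cap_nonneg _)

theorem sub_mem_of_mem_min {s w u c B : ℝ} (hs : s ∈ Icc 0 c) (hw : w ∈ Icc 0 B)
    (hu : u ∈ Icc 0 (min s w)) : s - u ∈ Icc 0 c ∧ w - u ∈ Icc 0 B := by
  have h1 := hu.2.trans (min_le_left _ _)
  have h2 := hu.2.trans (min_le_right _ _)
  have h3 := hu.1
  exact ⟨⟨by linarith, by linarith [hs.2]⟩, ⟨by linarith, by linarith [hw.2]⟩⟩

theorem clampedObjective_eq (J : ℝ → ℝ → ℝ) {s w u : ℝ} (hs : s ∈ Icc 0 m.cap)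
    (hw : w ∈ Icc 0 m.B) (hu : u ∈ Icc 0 (min s w)) :
    m.clampedObjective J (s, w) u = m.bellmanObjective J s w u := by
  obtain ⟨h1, h2⟩ := sub_mem_of_mem_min hs hw hu
  unfold clampedObjective bellmanObjective stepValue
  rw [clamp_of_mem hs, clamp_of_mem hw, clamp_of_mem h1, clamp_of_mem h2]

theorem Assumptions.continuousOn_bellmanObjective (hm : m.Assumptions) {J : ℝ → ℝ → ℝ}
    (hJ : m.HasExpectations J) {s w : ℝ} (hs : s ∈ Icc 0 m.cap) (hw : w ∈ Icc 0 m.B) :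
    ContinuousOn (m.bellmanObjective J s w) (Icc 0 (min s w)) := by
  refine ContinuousOn.congr (f := m.clampedObjective J (s, w)) ?_
    fun u hu => (clampedObjective_eq J hs hw hu).symm
  exact ((hm.continuous_clampedObjective hJ).comp
    (continuous_const.prodMk continuous_id)).continuousOn

theorem Assumptions.isLeast_bellman (hm : m.Assumptions) {J : ℝ → ℝ → ℝ}
    (hJ : m.HasExpectations J) {s w : ℝ} (hs : s ∈ Icc 0 m.cap) (hw : w ∈ Icc 0 m.B) :
    IsLeast (m.bellmanObjective J s w '' Icc 0 (min s w)) (m.bellman J s w) :=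
  isLeast_sInf_image_Icc (le_min hs.1 hw.1) (hm.continuousOn_bellmanObjective hJ hs hw)

theorem Assumptions.isMinOn_bellmanObjective_iff (hm : m.Assumptions) {J : ℝ → ℝ → ℝ}
    (hJ : m.HasExpectations J) {s w u : ℝ} (hs : s ∈ Icc 0 m.cap) (hw : w ∈ Icc 0 m.B)
    (hu : u ∈ Icc 0 (min s w)) :
    IsMinOn (m.bellmanObjective J s w) (Icc 0 (min s w)) u ↔
      m.bellmanObjective J s w u = m.bellman J s w := by
  have hl := hm.isLeast_bellman hJ hs hw
  rw [isMinOn_iff]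
  constructor
  · intro h
    obtain ⟨v, hv, hve⟩ := hl.1
    exact le_antisymm ((h v hv).trans hve.le) (hl.2 (mem_image_of_mem _ hu))
  · intro h v hv
    rw [h]
    exact hl.2 (mem_image_of_mem _ hv)

theorem bellman_clamp (hm : m.Assumptions) (J : ℝ → ℝ → ℝ) (p : ℝ × ℝ) :
    m.bellman J (clamp m.cap p.1) (clamp m.B p.2) =
      sInf (m.clampedObjective J p '' Icc 0 (min (clamp m.cap p.1) (clamp m.B p.2))) := by
  have h1 := clamp_mem hm.cap_nonneg p.1
  have h2 := clamp_mem hm.B_nonneg p.2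
  unfold bellman
  congr 1
  refine image_congr fun u hu => ?_
  rw [← clampedObjective_eq J h1 h2 hu]
  simp only [clampedObjective, clamp_of_mem h1, clamp_of_mem h2]

theorem Assumptions.continuous_bellman_clamp (hm : m.Assumptions) {J : ℝ → ℝ → ℝ}
    (hJ : m.HasExpectations J) :
    Continuous fun p : ℝ × ℝ => m.bellman J (clamp m.cap p.1) (clamp m.B p.2) := by
  simp_rw [bellman_clamp hm]
  have hc := continuous_clamp m.cap
  have hB := continuous_clamp m.B
  exact continuous_sInf_image_Icc (F := m.clampedObjective J)
    (hm.continuous_clampedObjective hJ) (by fun_prop)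
    fun p => le_min (clamp_mem hm.cap_nonneg _).1 (clamp_mem hm.B_nonneg _).1

/-- One application of `T` turns any regular `J`, possibly unbounded and discontinuous, into the
restriction of a bounded continuous function. This brings all regular functions into the reach of
Banach's theorem. -/
theorem Assumptions.exists_bellmanClamp (hm : m.Assumptions) {J : ℝ → ℝ → ℝ}
    (hJ : m.HasExpectations J) :
    ∃ v : ℝ × ℝ →ᵇ ℝ, ∀ p, v p = m.bellman J (clamp m.cap p.1) (clamp m.B p.2) := by
  have hc := hm.continuous_bellman_clamp hJ
  obtain ⟨C, hC⟩ := (isCompact_Icc.prod isCompact_Icc :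
    IsCompact (Icc 0 m.cap ×ˢ Icc 0 m.B)).exists_bound_of_continuousOn hc.continuousOn
  refine ⟨.ofNormedAddCommGroup _ hc C fun p => ?_, fun p => rfl⟩
  have h1 := clamp_mem hm.cap_nonneg p.1
  have h2 := clamp_mem hm.B_nonneg p.2
  simpa [clamp_of_mem h1, clamp_of_mem h2] using
    hC (clamp m.cap p.1, clamp m.B p.2) ⟨h1, h2⟩

theorem Assumptions.hasExpectations_bcf (hm : m.Assumptions) (v : ℝ × ℝ →ᵇ ℝ) :
    m.HasExpectations fun s w => v (s, w) :=
  hm.hasExpectations_of_bounded (C := ‖v‖) v.continuous.measurable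
    fun _ _ => v.norm_coe_le_norm _

theorem Assumptions.hasExpectations_bellman (hm : m.Assumptions) {J : ℝ → ℝ → ℝ}
    (hJ : m.HasExpectations J) : m.HasExpectations (m.bellman J) := by
  obtain ⟨v, hv⟩ := hm.exists_bellmanClamp hJ
  refine hm.hasExpectations_congr (fun s hs w hw => ?_) (hm.hasExpectations_bcf v)
  rw [hv, clamp_of_mem hs, clamp_of_mem hw]

theorem Assumptions.bellman_congr (hm : m.Assumptions) {J J' : ℝ → ℝ → ℝ}
    (h : ∀ s ∈ Icc 0 m.cap, ∀ w ∈ Icc 0 m.B, J s w = J' s w) {s w : ℝ} (hs : s ∈ Icc 0 m.cap)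
    (hw : w ∈ Icc 0 m.B) : m.bellman J s w = m.bellman J' s w := by
  unfold bellman
  congr 1
  refine image_congr fun u hu => ?_
  exact congrArg _ (hm.stepValue_congr h (sub_mem_of_mem_min hs hw hu).1.1)

/-- A minimizer for `J'` serves as a competitor for `J`. -/
theorem Assumptions.bellman_le_add (hm : m.Assumptions) {J J' : ℝ → ℝ → ℝ}
    (hJ : m.HasExpectations J) (hJ' : m.HasExpectations J') {D : ℝ}
    (h : ∀ s ∈ Icc 0 m.cap, ∀ w ∈ Icc 0 m.B, J s w ≤ J' s w + D) {s w : ℝ}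
    (hs : s ∈ Icc 0 m.cap) (hw : w ∈ Icc 0 m.B) :
    m.bellman J s w ≤ m.bellman J' s w + m.stepDiscount * D := by
  obtain ⟨u, hu, hue⟩ := (hm.isLeast_bellman hJ' hs hw).1
  refine ((hm.isLeast_bellman hJ hs hw).2 (mem_image_of_mem _ hu)).trans ?_
  have h1 := hm.stepValue_le_add hJ hJ' h (sub_mem_of_mem_min hs hw hu).1
  rw [← hue]
  unfold bellmanObjective
  unfold stepValue at h1
  linarith

/-- The Bellman operator on bounded continuous functions. -/
def bellmanBCF (hm : m.Assumptions) (v : ℝ × ℝ →ᵇ ℝ) : ℝ × ℝ →ᵇ ℝ :=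
  (hm.exists_bellmanClamp (hm.hasExpectations_bcf v)).choose

theorem bellmanBCF_apply (hm : m.Assumptions) (v : ℝ × ℝ →ᵇ ℝ) {s w : ℝ} (hs : s ∈ Icc 0 m.cap)
    (hw : w ∈ Icc 0 m.B) : bellmanBCF hm v (s, w) = m.bellman (fun s w => v (s, w)) s w := by
  have := (hm.exists_bellmanClamp (hm.hasExpectations_bcf v)).choose_spec (s, w)
  rwa [clamp_of_mem hs, clamp_of_mem hw] at this

theorem bellmanBCF_eq (hm : m.Assumptions) (v : ℝ × ℝ →ᵇ ℝ) {J : ℝ → ℝ → ℝ}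
    (h : ∀ s ∈ Icc 0 m.cap, ∀ w ∈ Icc 0 m.B, v (s, w) = J s w) {v' : ℝ × ℝ →ᵇ ℝ}
    (hv' : ∀ p, v' p = m.bellman J (clamp m.cap p.1) (clamp m.B p.2)) :
    bellmanBCF hm v = v' := by
  ext p
  rw [hv', bellmanBCF, (hm.exists_bellmanClamp (hm.hasExpectations_bcf v)).choose_spec]
  exact hm.bellman_congr h (clamp_mem hm.cap_nonneg _) (clamp_mem hm.B_nonneg _)

theorem contractingWith_bellmanBCF (hm : m.Assumptions) :
    ContractingWith ⟨m.stepDiscount, m.stepDiscount_nonneg⟩ (bellmanBCF hm) := by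
  refine ⟨by exact_mod_cast hm.stepDiscount_lt_one, LipschitzWith.of_dist_le_mul fun v v' => ?_⟩
  refine (BoundedContinuousFunction.dist_le
    (mul_nonneg m.stepDiscount_nonneg dist_nonneg)).2 fun p => ?_
  unfold bellmanBCF
  rw [(hm.exists_bellmanClamp (hm.hasExpectations_bcf v)).choose_spec,
    (hm.exists_bellmanClamp (hm.hasExpectations_bcf v')).choose_spec, Real.dist_eq, abs_sub_le_iff]
  have key : ∀ v v' : ℝ × ℝ →ᵇ ℝ, ∀ s ∈ Icc 0 m.cap, ∀ w ∈ Icc 0 m.B,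
      m.bellman (fun s w => v (s, w)) s w - m.bellman (fun s w => v' (s, w)) s w ≤
        m.stepDiscount * dist v v' := by
    intro v v' s hs w hw
    rw [sub_le_iff_le_add']
    refine hm.bellman_le_add (hm.hasExpectations_bcf v) (hm.hasExpectations_bcf v') ?_ hs hw
    intro s _ w _
    have h1 := (abs_sub_le_iff.1 ((Real.dist_eq _ _).symm.trans_le
      (BoundedContinuousFunction.dist_coe_le_dist (f := v) (g := v') (s, w)))).1
    linarith
  refine ⟨key v v' _ (clamp_mem hm.cap_nonneg _) _ (clamp_mem hm.B_nonneg _), ?_⟩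
  rw [dist_comm v v']
  exact key v' v _ (clamp_mem hm.cap_nonneg _) _ (clamp_mem hm.B_nonneg _)

/-- The bounded continuous solution of the Bellman equation. -/
def bellmanFixedPoint (hm : m.Assumptions) : ℝ × ℝ →ᵇ ℝ :=
  ContractingWith.fixedPoint (bellmanBCF hm) (contractingWith_bellmanBCF hm)

theorem bellmanFixedPoint_eq (hm : m.Assumptions) {s w : ℝ} (hs : s ∈ Icc 0 m.cap)
    (hw : w ∈ Icc 0 m.B) :
    bellmanFixedPoint hm (s, w) = m.bellman (fun s w => bellmanFixedPoint hm (s, w)) s w := by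
  have h : bellmanBCF hm (bellmanFixedPoint hm) = bellmanFixedPoint hm :=
    (contractingWith_bellmanBCF hm).fixedPoint_isFixedPt
  rw [← bellmanBCF_apply hm _ hs hw, h]

/-- Since `J = T J`, the continuous extension of `T J` agrees with `J` on the rectangle and is
itself a fixed point of `bellmanBCF`. -/
theorem eq_bellmanFixedPoint (hm : m.Assumptions) {J : ℝ → ℝ → ℝ} (hJ : m.HasExpectations J)
    (h : ∀ s ∈ Icc 0 m.cap, ∀ w ∈ Icc 0 m.B, J s w = m.bellman J s w) {s w : ℝ}
    (hs : s ∈ Icc 0 m.cap) (hw : w ∈ Icc 0 m.B) : J s w = bellmanFixedPoint hm (s, w) := by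
  obtain ⟨v, hv⟩ := hm.exists_bellmanClamp hJ
  have hvJ : ∀ s ∈ Icc 0 m.cap, ∀ w ∈ Icc 0 m.B, v (s, w) = J s w := by
    intro s hs w hw
    rw [hv, clamp_of_mem hs, clamp_of_mem hw, h s hs w hw]
  have hfix : Function.IsFixedPt (bellmanBCF hm) v := bellmanBCF_eq hm v hvJ hv
  rw [← hvJ s hs w hw, (contractingWith_bellmanBCF hm).fixedPoint_unique hfix]
  rfl

theorem tendstoUniformlyOn_bellman_iterate (hm : m.Assumptions) {J : ℝ → ℝ → ℝ}
    (hJ : m.HasExpectations J) :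
    TendstoUniformlyOn (fun (k : ℕ) (p : ℝ × ℝ) => (m.bellman^[k] J) p.1 p.2)
      (bellmanFixedPoint hm) atTop (Icc 0 m.cap ×ˢ Icc 0 m.B) := by
  obtain ⟨v, hv⟩ := hm.exists_bellmanClamp hJ
  -- The index is shifted by one because `J` itself need not be bounded or continuous; the
  -- contraction is iterated from `T J`.
  have hiter : ∀ k : ℕ, ∀ s ∈ Icc 0 m.cap, ∀ w ∈ Icc 0 m.B,
      ((bellmanBCF hm)^[k] v) (s, w) = (m.bellman^[k + 1] J) s w := by
    intro k
    induction k with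
    | zero =>
      intro s hs w hw
      simp [hv, clamp_of_mem hs, clamp_of_mem hw]
    | succ k ih =>
      intro s hs w hw
      rw [Function.iterate_succ_apply', Function.iterate_succ_apply', bellmanBCF_apply hm _ hs hw]
      exact hm.bellman_congr ih hs hw
  have h1 := (BoundedContinuousFunction.tendsto_iff_tendstoUniformly.1
    ((contractingWith_bellmanBCF hm).tendsto_iterate_fixedPoint v)).tendstoUniformlyOn
      (s := Icc 0 m.cap ×ˢ Icc 0 m.B)
  have h2 : TendstoUniformlyOn (fun (k : ℕ) (p : ℝ × ℝ) => (m.bellman^[k + 1] J) p.1 p.2)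
      (bellmanFixedPoint hm) atTop (Icc 0 m.cap ×ˢ Icc 0 m.B) :=
    h1.congr (.of_forall fun k p hp => hiter k p.1 hp.1 p.2 hp.2)
  intro U hU
  obtain ⟨N, hN⟩ := eventually_atTop.1 (h2 U hU)
  filter_upwards [eventually_ge_atTop (N + 1)] with k hk p hp
  have h3 : (_, (m.bellman^[k - 1 + 1] J) p.1 p.2) ∈ U := hN (k - 1) (by omega) p hp
  rwa [Nat.sub_add_cancel (by omega)] at h3

theorem exists_greedy_policy (hm : m.Assumptions) :
    ∃ μ, m.IsPolicy μ ∧ ∀ s ∈ Icc 0 m.cap, ∀ w ∈ Icc 0 m.B,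
      m.bellmanObjective (fun s w => bellmanFixedPoint hm (s, w)) s w (μ s w) =
        bellmanFixedPoint hm (s, w) := by
  have hc := continuous_clamp m.cap
  have hB := continuous_clamp m.B
  obtain ⟨u, hu, hmin⟩ := exists_measurable_minimizer
    (hm.continuous_clampedObjective (hm.hasExpectations_bcf (bellmanFixedPoint hm)))
    (b := fun p : ℝ × ℝ => min (clamp m.cap p.1) (clamp m.B p.2)) (by fun_prop)
    (fun p => le_min (clamp_mem hm.cap_nonneg _).1 (clamp_mem hm.B_nonneg _).1)
  have hmem : ∀ s ∈ Icc 0 m.cap, ∀ w ∈ Icc 0 m.B, u (s, w) ∈ Icc 0 (min s w) := by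
    intro s hs w hw
    simpa only [clamp_of_mem hs, clamp_of_mem hw] using (hmin (s, w)).1
  refine ⟨fun s w => u (s, w), ⟨hu, hmem⟩, fun s hs w hw => ?_⟩
  rw [← clampedObjective_eq _ hs hw (hmem s hs w hw), (hmin (s, w)).2,
    ← bellman_clamp hm _ (s, w), clamp_of_mem hs, clamp_of_mem hw, ← bellmanFixedPoint_eq hm hs hw]

end StorageModel

end

/-! ### Discounted rewards along the controlled process. -/

theorem ae_summable_and_integrable_tsum {Ω : Type*} [MeasurableSpace Ω] {P : Measure Ω}
    {F : ℕ → Ω → ℝ} (hF : ∀ k, Integrable (F k) P) (hs : Summable fun k => ∫ ω, ‖F k ω‖ ∂P) :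
    (∀ᵐ ω ∂P, Summable fun k => F k ω) ∧ Integrable (fun ω => ∑' k, F k ω) P := by
  have hfin : ∫⁻ ω, ∑' k, ‖F k ω‖ₑ ∂P < ⊤ := by
    rw [lintegral_tsum fun k => (hF k).1.enorm]
    simp_rw [← ofReal_integral_norm_eq_lintegral_enorm (hF _)]
    exact hs.tsum_ofReal_lt_top
  have hsum : ∀ᵐ ω ∂P, Summable fun k => ‖F k ω‖ := by
    filter_upwards [ae_lt_top' (AEMeasurable.tsum fun k => (hF k).1.enorm) hfin.ne]
      with ω hω using tsum_enorm_ne_top_iff_summable_norm.1 hω.ne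
  refine ⟨hsum.mono fun ω h => h.of_norm, ?_, ?_⟩
  · refine aestronglyMeasurable_of_tendsto_ae (f := fun n ω => ∑ k ∈ Finset.range n, F k ω) atTop
      (fun n => (integrable_finsetSum _ fun k _ => hF k).1) ?_
    filter_upwards [hsum] with ω h using h.of_norm.hasSum.tendsto_sum_nat
  · refine lt_of_le_of_lt (lintegral_mono fun ω => ?_) hfin
    exact enorm_tsum_le_tsum_enorm

noncomputable section

namespace StorageModel

variable {m : StorageModel} {Ω : Type*} [MeasurableSpace Ω] {P : Measure Ω} {τ W : ℕ → Ω → ℝ}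
  {μ : ℝ → ℝ → ℝ} {s : ℝ}

/-- The discounted reward `f` of the `k`-th shock. -/
def discountedReward (m : StorageModel) (τ W : ℕ → Ω → ℝ) (μ : ℝ → ℝ → ℝ) (s : ℝ)
    (f : ℝ → ℝ → ℝ) (k : ℕ) (ω : Ω) : ℝ :=
  Real.exp (-m.θ * arrivalTime τ k ω) * f (m.levelBefore τ W μ s k ω) (W k ω)

theorem arrivalTime_succ {α : Type*} (τ : ℕ → α → ℝ) (k : ℕ) (ω : α) :
    arrivalTime τ (k + 1) ω = arrivalTime τ k ω + τ (k + 1) ω :=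
  Finset.sum_range_succ _ _

/-- The general `𝓕` serves two purposes: a constant family gives plain measurability, and the
natural filtration gives the adaptedness used for independence. -/
theorem measurable_history {α : Type*} {τ W : ℕ → α → ℝ} {𝓕 : ℕ → MeasurableSpace α} (hmono : Monotone 𝓕)
    (hτ : ∀ k, Measurable[𝓕 k] (τ k)) (hW : ∀ k, Measurable[𝓕 k] (W k))
    (hμ : Measurable (Function.uncurry μ)) (k : ℕ) :
    Measurable[𝓕 k] (arrivalTime τ k) ∧ Measurable[𝓕 k] (m.levelBefore τ W μ s k) := by
  induction k with
  | zero =>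
    have h0 := hτ 0
    refine ⟨?_, ?_⟩
    · have : arrivalTime τ 0 = τ 0 := by ext ω; simp [arrivalTime]
      rwa [this]
    · exact (m.measurable_fill).comp (measurable_const.prodMk h0)
  | succ k ih =>
    have hle : 𝓕 k ≤ 𝓕 (k + 1) := hmono k.le_succ
    have h1 := ih.1.mono hle le_rfl
    have h2 := ih.2.mono hle le_rfl
    have h3 := (hW k).mono hle le_rfl
    have h4 := hτ (k + 1)
    refine ⟨?_, ?_⟩
    · have : arrivalTime τ (k + 1) = fun ω => arrivalTime τ k ω + τ (k + 1) ω :=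
        funext fun ω => arrivalTime_succ τ k ω
      rw [this]
      exact h1.add h4
    · exact (m.measurable_fill).comp ((h2.sub (hμ.comp (h2.prodMk h3))).prodMk h4)

namespace IsCompoundPoisson

theorem ae_mem (hm : m.Assumptions) (hP : m.IsCompoundPoisson P τ W) :
    ∀ᵐ ω ∂P, ∀ k, 0 < τ k ω ∧ W k ω ∈ Icc 0 m.B := by
  refine ae_all_iff.2 fun k => ?_
  have h := hm.ae_stepLaw
  rw [← hP.law k] at h
  exact ae_of_ae_map ((hP.measurable_time k).prodMk (hP.measurable_size k)).aemeasurable h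

theorem ae_level_mem (hm : m.Assumptions) (hP : m.IsCompoundPoisson P τ W) (hμ : m.IsPolicy μ)
    (hs : s ∈ Icc 0 m.cap) :
    ∀ᵐ ω ∂P, ∀ k, m.levelBefore τ W μ s k ω ∈ Icc 0 m.cap ∧ W k ω ∈ Icc 0 m.B ∧
      0 ≤ arrivalTime τ k ω := by
  filter_upwards [hP.ae_mem hm] with ω hω k
  refine ⟨?_, (hω k).2, Finset.sum_nonneg fun i _ => (hω i).1.le⟩
  induction k with
  | zero => exact hm.fill_mem hs.1 (hω 0).1.le
  | succ k ih =>
    exact hm.fill_mem (sub_mem_of_mem_min ih (hω k).2 (hμ.2 _ ih _ (hω k).2)).1.1 (hω (k + 1)).1.le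

theorem measurable_discountedReward (hP : m.IsCompoundPoisson P τ W) (hμ : m.IsPolicy μ)
    {f : ℝ → ℝ → ℝ} (hf : Measurable (Function.uncurry f)) (k : ℕ) :
    Measurable (m.discountedReward τ W μ s f k) := by
  have h := measurable_history (m := m) (s := s) (𝓕 := fun _ => inferInstance) monotone_const
    hP.measurable_time hP.measurable_size hμ.1 k
  have h1 := h.1
  exact Measurable.mul (by fun_prop) (hf.comp (h.2.prodMk (hP.measurable_size k)))

theorem integrable_discountedReward [IsProbabilityMeasure P] (hm : m.Assumptions)
    (hP : m.IsCompoundPoisson P τ W) (hμ : m.IsPolicy μ) (hs : s ∈ Icc 0 m.cap)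
    {f : ℝ → ℝ → ℝ} (hf : Measurable (Function.uncurry f)) {C : ℝ} (hC : ∀ s w, |f s w| ≤ C)
    (k : ℕ) : Integrable (m.discountedReward τ W μ s f k) P := by
  refine Integrable.of_bound (C := C) (hP.measurable_discountedReward hμ hf k).aestronglyMeasurable
    ?_
  filter_upwards [hP.ae_level_mem hm hμ hs] with ω hω
  rw [discountedReward, norm_mul, Real.norm_of_nonneg (Real.exp_pos _).le, Real.norm_eq_abs]
  exact (mul_le_of_le_one_left (abs_nonneg _) (hm.discount_le_one (hω k).2.2)).trans (hC _ _)

/-- The discount factor and the level just after shock `k` are functions of the pairs up to index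
`k`, which are independent of the next pair. -/
theorem indepFun_history (hP : m.IsCompoundPoisson P τ W)
    (hμ : Measurable (Function.uncurry μ)) (k : ℕ) :
    IndepFun (fun ω => (Real.exp (-m.θ * arrivalTime τ k ω),
        m.levelBefore τ W μ s k ω - μ (m.levelBefore τ W μ s k ω) (W k ω)))
      (fun ω => (τ (k + 1) ω, W (k + 1) ω)) P := by
  have hZ : ∀ i, StronglyMeasurable fun ω => (τ i ω, W i ω) := fun i =>
    ((hP.measurable_time i).prodMk (hP.measurable_size i)).stronglyMeasurable
  have hind := hP.indep.indep_comap_natural_of_lt hZ k.lt_succ_self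
  set 𝓕 := Filtration.natural (fun i ω => (τ i ω, W i ω)) hZ
  have had : ∀ i, Measurable[𝓕 i] fun ω => (τ i ω, W i ω) := fun i =>
    (Filtration.stronglyAdapted_natural hZ i).measurable
  have hW : ∀ i, Measurable[𝓕 i] (W i) := fun i => measurable_snd.comp (had i)
  obtain ⟨h1, h2⟩ := measurable_history (m := m) (s := s) (𝓕 := 𝓕) 𝓕.mono'
    (fun i => measurable_fst.comp (had i)) hW hμ k
  rw [IndepFun_iff_Indep]
  refine indep_of_indep_of_le_left hind.symm (Measurable.comap_le ?_)
  exact ((h1.const_mul (-m.θ)).exp).prodMk (h2.sub (hμ.comp (h2.prodMk (hW k))))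

/-- The expected discounted reward of the first shock. -/
theorem integral_discountedReward_zero (hP : m.IsCompoundPoisson P τ W)
    {f : ℝ → ℝ → ℝ} (hf : Measurable (Function.uncurry f)) :
    ∫ ω, m.discountedReward τ W μ s f 0 ω ∂P = m.stepValue f s := by
  have hmeas : Measurable fun p : ℝ × ℝ => Real.exp (-m.θ * p.1) * f (m.fill s p.1) p.2 :=
    (m.measurable_step hf).comp (measurable_const.prodMk measurable_id)
  rw [stepValue, ← hP.law 0, integral_map
    ((hP.measurable_time 0).prodMk (hP.measurable_size 0)).aemeasurable
    hmeas.aestronglyMeasurable]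
  simp [discountedReward, arrivalTime, levelBefore]

/-- The Markov property: the expected discounted reward of a shock as that of the preceding one. -/
theorem integral_discountedReward_succ [IsProbabilityMeasure P] (hm : m.Assumptions)
    (hP : m.IsCompoundPoisson P τ W) (hμ : m.IsPolicy μ) (hs : s ∈ Icc 0 m.cap)
    {f : ℝ → ℝ → ℝ} (hf : Measurable (Function.uncurry f)) {C : ℝ} (hC : ∀ s w, |f s w| ≤ C)
    (k : ℕ) : ∫ ω, m.discountedReward τ W μ s f (k + 1) ω ∂P =
      ∫ ω, m.discountedReward τ W μ s (fun s w => m.stepValue f (s - μ s w)) k ω ∂P := by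
  have := hm.isProbabilityMeasure_stepLaw
  set Y : Ω → ℝ × ℝ := fun ω => (Real.exp (-m.θ * arrivalTime τ k ω),
    m.levelBefore τ W μ s k ω - μ (m.levelBefore τ W μ s k ω) (W k ω)) with hY
  set Z : Ω → ℝ × ℝ := fun ω => (τ (k + 1) ω, W (k + 1) ω) with hZ
  set Φ : (ℝ × ℝ) × (ℝ × ℝ) → ℝ := fun q =>
    q.1.1 * (Real.exp (-m.θ * q.2.1) * f (m.fill q.1.2 q.2.1) q.2.2) with hΦ
  have hist := measurable_history (m := m) (s := s) (μ := μ) (𝓕 := fun _ => inferInstance)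
    monotone_const hP.measurable_time hP.measurable_size hμ.1 k
  have h1 := hist.1
  have hYm : Measurable Y := Measurable.prodMk (by fun_prop)
    (hist.2.sub (hμ.1.comp (hist.2.prodMk (hP.measurable_size k))))
  have hZm : Measurable Z := (hP.measurable_time (k + 1)).prodMk (hP.measurable_size (k + 1))
  have hstep : Measurable fun q : (ℝ × ℝ) × (ℝ × ℝ) =>
      Real.exp (-m.θ * q.2.1) * f (m.fill q.1.2 q.2.1) q.2.2 :=
    (m.measurable_step hf).comp ((measurable_snd.comp measurable_fst).prodMk measurable_snd)
  have hΦm : Measurable Φ := Measurable.mul (by fun_prop) hstep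
  -- By independence the joint law is a product, so Fubini integrates the next pair out first. With
  -- the post-shock level fixed, that inner integral is a `stepValue`.
  have hlaw : P.map (fun ω => (Y ω, Z ω)) = (P.map Y).prod m.stepLaw := by
    rw [(indepFun_iff_map_prod_eq_prod_map_map hYm.aemeasurable hZm.aemeasurable).1
      (hP.indepFun_history hμ.1 k), hP.law (k + 1)]
  have hcomp : m.discountedReward τ W μ s f (k + 1) = fun ω => Φ (Y ω, Z ω) := by
    ext ω
    simp only [discountedReward, arrivalTime_succ, levelBefore, hΦ, hY, hZ]
    rw [mul_add, Real.exp_add, mul_assoc]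
  have hint : Integrable Φ ((P.map Y).prod m.stepLaw) := by
    rw [← hlaw, integrable_map_measure hΦm.aestronglyMeasurable (hYm.prodMk hZm).aemeasurable]
    have := hP.integrable_discountedReward hm hμ hs hf hC (k + 1)
    rwa [hcomp] at this
  have : IsProbabilityMeasure (P.map Y) := Measure.isProbabilityMeasure_map hYm.aemeasurable
  have hval : Measurable fun y : ℝ × ℝ => y.1 * m.stepValue f y.2 := by
    refine Measurable.mul (by fun_prop) ?_
    exact (hstep.stronglyMeasurable.integral_prod_right').measurable
  rw [hcomp, ← integral_map (hYm.prodMk hZm).aemeasurable hΦm.aestronglyMeasurable, hlaw,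
    integral_prod _ hint]
  simp_rw [hΦ, integral_const_mul]
  exact integral_map hYm.aemeasurable hval.aestronglyMeasurable

/-- The constant reward `1` isolates the discount. The exponent is `k + 1` because arrival `k` comes
after `k + 1` interarrival times. This gives the geometric bound for all bounded rewards. -/
theorem integral_discountedReward_one [IsProbabilityMeasure P] (hm : m.Assumptions)
    (hP : m.IsCompoundPoisson P τ W) (hμ : m.IsPolicy μ) (hs : s ∈ Icc 0 m.cap) (k : ℕ) :
    ∫ ω, m.discountedReward τ W μ s (fun _ _ => 1) k ω ∂P = m.stepDiscount ^ (k + 1) := by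
  have hstep : ∀ x, m.stepValue (fun _ _ => 1) x = m.stepDiscount := by
    simp [stepValue, stepDiscount]
  induction k with
  | zero => rw [hP.integral_discountedReward_zero measurable_const, hstep, zero_add, pow_one]
  | succ k ih =>
    rw [hP.integral_discountedReward_succ hm hμ hs measurable_const (C := 1) (by simp),
      pow_succ, ← ih, ← integral_mul_const]
    simp [hstep, discountedReward]

theorem integral_norm_discountedReward_le [IsProbabilityMeasure P] (hm : m.Assumptions)
    (hP : m.IsCompoundPoisson P τ W) (hμ : m.IsPolicy μ) (hs : s ∈ Icc 0 m.cap)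
    {f : ℝ → ℝ → ℝ} (hf : Measurable (Function.uncurry f)) {C : ℝ} (hC : ∀ s w, |f s w| ≤ C)
    (k : ℕ) :
    ∫ ω, ‖m.discountedReward τ W μ s f k ω‖ ∂P ≤ m.stepDiscount ^ (k + 1) * C := by
  rw [← hP.integral_discountedReward_one hm hμ hs k, ← integral_mul_const]
  refine integral_mono (hP.integrable_discountedReward hm hμ hs hf hC k).norm
    ((hP.integrable_discountedReward hm hμ hs measurable_const (C := 1) (by simp) k).mul_const _)
    fun ω => ?_
  simp only [discountedReward, norm_mul, Real.norm_of_nonneg (Real.exp_pos _).le, mul_one,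
    Real.norm_eq_abs]
  exact mul_le_mul_of_nonneg_left (hC _ _) (Real.exp_pos _).le

end IsCompoundPoisson

end StorageModel

end

/-! ### The Bellman defect and the excess cost of a policy. -/

noncomputable section

namespace StorageModel

variable {m : StorageModel} {Ω : Type*} [MeasurableSpace Ω] {P : Measure Ω} {τ W : ℕ → Ω → ℝ}
  {μ : ℝ → ℝ → ℝ} {s : ℝ}

theorem Assumptions.measurable_stepValue (hm : m.Assumptions) {f : ℝ → ℝ → ℝ}
    (hf : Measurable (Function.uncurry f)) : Measurable (m.stepValue f) := by
  have := hm.isProbabilityMeasure_stepLaw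
  exact ((m.measurable_step hf).stronglyMeasurable.integral_prod_right').measurable

theorem Assumptions.abs_stepValue_le (hm : m.Assumptions) {f : ℝ → ℝ → ℝ} {C : ℝ}
    (hC : ∀ s w, |f s w| ≤ C) (x : ℝ) : |m.stepValue f x| ≤ C := by
  have := hm.isProbabilityMeasure_stepLaw
  have h := norm_integral_le_of_norm_le_const (μ := m.stepLaw) (C := C)
    (f := fun p : ℝ × ℝ => Real.exp (-m.θ * p.1) * f (m.fill x p.1) p.2) ?_
  · simpa [stepValue] using h
  · filter_upwards [hm.ae_stepLaw] with p hp
    rw [norm_mul, Real.norm_of_nonneg (Real.exp_pos _).le, Real.norm_eq_abs]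
    exact (mul_le_of_le_one_left (abs_nonneg _) (hm.discount_le_one hp.1.le)).trans (hC _ _)

/-- The cost of one shock under the policy `μ`. -/
def policyStageCost (m : StorageModel) (μ : ℝ → ℝ → ℝ) (s w : ℝ) : ℝ :=
  m.g (clamp m.B (w - μ s w))

theorem Assumptions.measurable_policyStageCost (hm : m.Assumptions) (hμ : m.IsPolicy μ) :
    Measurable (Function.uncurry (m.policyStageCost μ)) :=
  hm.continuous_g_clamp.measurable.comp (measurable_snd.sub hμ.1)

theorem Assumptions.exists_bound_policyStageCost (hm : m.Assumptions) (μ : ℝ → ℝ → ℝ) :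
    ∃ C, ∀ s w, |m.policyStageCost μ s w| ≤ C := by
  obtain ⟨C, hC⟩ := hm.g_bounded
  exact ⟨C, fun s w => hC _ (clamp_mem hm.B_nonneg _)⟩

/-- The solution of the Bellman equation, in curried form. -/
def optimalValue (hm : m.Assumptions) (s w : ℝ) : ℝ := bellmanFixedPoint hm (s, w)

theorem measurable_optimalValue (hm : m.Assumptions) :
    Measurable (Function.uncurry (optimalValue hm)) :=
  (bellmanFixedPoint hm).continuous.measurable

theorem abs_optimalValue_le (hm : m.Assumptions) (s w : ℝ) :
    |optimalValue hm s w| ≤ ‖bellmanFixedPoint hm‖ :=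
  (bellmanFixedPoint hm).norm_coe_le_norm _

theorem hasExpectations_optimalValue (hm : m.Assumptions) :
    m.HasExpectations (optimalValue hm) :=
  hm.hasExpectations_bcf _

theorem optimalValue_eq (hm : m.Assumptions) {w : ℝ} (hs : s ∈ Icc 0 m.cap)
    (hw : w ∈ Icc 0 m.B) : optimalValue hm s w = m.bellman (optimalValue hm) s w :=
  bellmanFixedPoint_eq hm hs hw

/-- The loss incurred by following `μ` for one shock and acting optimally afterwards. -/
def bellmanDefect (hm : m.Assumptions) (μ : ℝ → ℝ → ℝ) (s w : ℝ) : ℝ :=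
  m.policyStageCost μ s w + m.stepValue (optimalValue hm) (s - μ s w) - optimalValue hm s w

theorem bellmanDefect_eq (hm : m.Assumptions) (hμ : m.IsPolicy μ) {w : ℝ} (hs : s ∈ Icc 0 m.cap)
    (hw : w ∈ Icc 0 m.B) : bellmanDefect hm μ s w =
      m.bellmanObjective (optimalValue hm) s w (μ s w) - optimalValue hm s w := by
  rw [bellmanDefect, policyStageCost,
    clamp_of_mem (sub_mem_of_mem_min hs hw (hμ.2 s hs w hw)).2]
  rfl

theorem bellmanDefect_nonneg (hm : m.Assumptions) (hμ : m.IsPolicy μ) {w : ℝ}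
    (hs : s ∈ Icc 0 m.cap) (hw : w ∈ Icc 0 m.B) : 0 ≤ bellmanDefect hm μ s w := by
  rw [bellmanDefect_eq hm hμ hs hw, sub_nonneg, optimalValue_eq hm hs hw]
  exact (hm.isLeast_bellman (hasExpectations_optimalValue hm) hs hw).2
    (mem_image_of_mem _ (hμ.2 s hs w hw))

theorem bellmanDefect_eq_zero_iff (hm : m.Assumptions) (hμ : m.IsPolicy μ) {w : ℝ}
    (hs : s ∈ Icc 0 m.cap) (hw : w ∈ Icc 0 m.B) : bellmanDefect hm μ s w = 0 ↔
      IsMinOn (m.bellmanObjective (optimalValue hm) s w) (Icc 0 (min s w)) (μ s w) := by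
  rw [hm.isMinOn_bellmanObjective_iff (hasExpectations_optimalValue hm) hs hw (hμ.2 s hs w hw),
    bellmanDefect_eq hm hμ hs hw, sub_eq_zero, ← optimalValue_eq hm hs hw]

theorem measurable_bellmanDefect (hm : m.Assumptions) (hμ : m.IsPolicy μ) :
    Measurable (Function.uncurry (bellmanDefect hm μ)) :=
  ((hm.measurable_policyStageCost hμ).add ((hm.measurable_stepValue
    (measurable_optimalValue hm)).comp (measurable_fst.sub hμ.1))).sub (measurable_optimalValue hm)

theorem exists_bound_bellmanDefect (hm : m.Assumptions) (μ : ℝ → ℝ → ℝ) :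
    ∃ C, ∀ s w, |bellmanDefect hm μ s w| ≤ C := by
  obtain ⟨C, hC⟩ := hm.exists_bound_policyStageCost μ
  refine ⟨C + ‖bellmanFixedPoint hm‖ + ‖bellmanFixedPoint hm‖, fun s w => ?_⟩
  refine (abs_sub _ _).trans (add_le_add ((abs_add_le _ _).trans (add_le_add (hC _ _) ?_)) ?_)
  · exact hm.abs_stepValue_le (abs_optimalValue_le hm) _
  · exact abs_optimalValue_le hm _ _

namespace IsCompoundPoisson

/-- Almost surely the trajectory stays in the rectangle, where the clamp acts as the identity. Costs
may thus be computed with a stage cost that is bounded and measurable on the whole plane. -/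
theorem ae_discountedStageCost_eq (hm : m.Assumptions) (hP : m.IsCompoundPoisson P τ W)
    (hμ : m.IsPolicy μ) (hs : s ∈ Icc 0 m.cap) :
    ∀ᵐ ω ∂P, ∀ k, m.discountedStageCost τ W μ s k ω =
      m.discountedReward τ W μ s (m.policyStageCost μ) k ω := by
  filter_upwards [hP.ae_level_mem hm hμ hs] with ω hω k
  obtain ⟨h1, h2, -⟩ := hω k
  rw [discountedReward, policyStageCost,
    clamp_of_mem (sub_mem_of_mem_min h1 h2 (hμ.2 _ h1 _ h2)).2]
  rfl

theorem integral_bellmanDefect_nonneg (hm : m.Assumptions) (hP : m.IsCompoundPoisson P τ W)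
    (hμ : m.IsPolicy μ) (hs : s ∈ Icc 0 m.cap) (k : ℕ) :
    0 ≤ ∫ ω, m.discountedReward τ W μ s (bellmanDefect hm μ) k ω ∂P := by
  refine integral_nonneg_of_ae ?_
  filter_upwards [hP.ae_level_mem hm hμ hs] with ω hω
  exact mul_nonneg (Real.exp_pos _).le (bellmanDefect_nonneg hm hμ (hω k).1 (hω k).2.1)

variable [IsProbabilityMeasure P]

theorem summable_integral_norm (hm : m.Assumptions) (hP : m.IsCompoundPoisson P τ W)
    (hμ : m.IsPolicy μ) (hs : s ∈ Icc 0 m.cap) {f : ℝ → ℝ → ℝ}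
    (hf : Measurable (Function.uncurry f)) {C : ℝ} (hC : ∀ s w, |f s w| ≤ C) :
    Summable fun k => ∫ ω, ‖m.discountedReward τ W μ s f k ω‖ ∂P := by
  refine Summable.of_nonneg_of_le (fun k => integral_nonneg fun ω => norm_nonneg _)
    (hP.integral_norm_discountedReward_le hm hμ hs hf hC) ?_
  exact ((summable_nat_add_iff 1).2 (summable_geometric_of_lt_one m.stepDiscount_nonneg
    hm.stepDiscount_lt_one)).mul_right C

theorem summable_and_integrable_cost (hm : m.Assumptions) (hP : m.IsCompoundPoisson P τ W)
    (hμ : m.IsPolicy μ) (hs : s ∈ Icc 0 m.cap) :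
    (∀ᵐ ω ∂P, Summable fun k => m.discountedStageCost τ W μ s k ω) ∧
      Integrable (fun ω => ∑' k, m.discountedStageCost τ W μ s k ω) P := by
  obtain ⟨C, hC⟩ := hm.exists_bound_policyStageCost μ
  have hmeas := hm.measurable_policyStageCost hμ
  obtain ⟨h1, h2⟩ := ae_summable_and_integrable_tsum
    (hP.integrable_discountedReward hm hμ hs hmeas hC)
    (hP.summable_integral_norm hm hμ hs hmeas hC)
  have hae := hP.ae_discountedStageCost_eq hm hμ hs
  refine ⟨?_, h2.congr ?_⟩
  · filter_upwards [h1, hae] with ω h h'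
    simpa only [h'] using h
  · filter_upwards [hae] with ω h
    simp only [h]

theorem hasSum_cost (hm : m.Assumptions) (hP : m.IsCompoundPoisson P τ W)
    (hμ : m.IsPolicy μ) (hs : s ∈ Icc 0 m.cap) :
    HasSum (fun k => ∫ ω, m.discountedReward τ W μ s (m.policyStageCost μ) k ω ∂P)
      (m.cost P τ W μ s) := by
  obtain ⟨C, hC⟩ := hm.exists_bound_policyStageCost μ
  have hmeas := hm.measurable_policyStageCost hμ
  have hcost : m.cost P τ W μ s =
      ∫ ω, ∑' k, m.discountedReward τ W μ s (m.policyStageCost μ) k ω ∂P := by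
    refine integral_congr_ae ?_
    filter_upwards [hP.ae_discountedStageCost_eq hm hμ hs] with ω h
    simp only [h]
  rw [hcost]
  exact hasSum_integral_of_summable_integral_norm
    (hP.integrable_discountedReward hm hμ hs hmeas hC)
    (hP.summable_integral_norm hm hμ hs hmeas hC)

/-- The excess cost of a policy over the solution of the Bellman equation is the total expected
discounted defect. -/
theorem tendsto_sum_bellmanDefect (hm : m.Assumptions) (hP : m.IsCompoundPoisson P τ W)
    (hμ : m.IsPolicy μ) (hs : s ∈ Icc 0 m.cap) :
    Tendsto (fun n => ∑ k ∈ Finset.range n,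
        ∫ ω, m.discountedReward τ W μ s (bellmanDefect hm μ) k ω ∂P) atTop
      (𝓝 (m.cost P τ W μ s - m.stepValue (optimalValue hm) s)) := by
  have hV := measurable_optimalValue hm
  have hVb := abs_optimalValue_le hm
  obtain ⟨C, hC⟩ := hm.exists_bound_policyStageCost μ
  have hc := hm.measurable_policyStageCost hμ
  set E : ℕ → ℝ := fun k => ∫ ω, m.discountedReward τ W μ s (optimalValue hm) k ω ∂P with hE
  set c : ℕ → ℝ := fun k => ∫ ω, m.discountedReward τ W μ s (m.policyStageCost μ) k ω ∂P with hc'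
  -- By the Markov property the continuation term of the defect at shock `k` has expectation `E (k +
  -- 1)`, so the contributions of `optimalValue` telescope.
  have hk : ∀ k, ∫ ω, m.discountedReward τ W μ s (bellmanDefect hm μ) k ω ∂P =
      c k + (E (k + 1) - E k) := by
    intro k
    simp only [hE, hc']
    rw [hP.integral_discountedReward_succ hm hμ hs hV hVb]
    have i1 := hP.integrable_discountedReward hm hμ hs hc hC k
    have i2 := hP.integrable_discountedReward hm hμ hs
      (f := fun s w => m.stepValue (optimalValue hm) (s - μ s w))
      ((hm.measurable_stepValue hV).comp (measurable_fst.sub hμ.1))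
      (fun s w => hm.abs_stepValue_le hVb _) k
    have i3 := hP.integrable_discountedReward hm hμ hs hV hVb k
    have i4 := integral_add i1 (i2.sub i3)
    rw [integral_sub' i2 i3] at i4
    rw [← i4]
    congr 1 with ω
    simp only [Pi.sub_apply]
    simp only [discountedReward, bellmanDefect]
    ring
  -- The remainder of the telescoping sum disappears: discounting makes the expected values of the
  -- bounded function `optimalValue` summable.
  have hlim : Tendsto E atTop (𝓝 0) := by
    have h1 := (hP.summable_integral_norm hm hμ hs hV hVb).tendsto_atTop_zero
    exact squeeze_zero_norm (fun k => norm_integral_le_integral_norm _) h1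
  have hE0 : E 0 = m.stepValue (optimalValue hm) s := hP.integral_discountedReward_zero hV
  have h := (hP.hasSum_cost hm hμ hs).tendsto_sum_nat.add (hlim.sub_const (E 0))
  rw [zero_sub, ← sub_eq_add_neg, hE0] at h
  refine h.congr fun n => ?_
  simp_rw [hk]
  rw [Finset.sum_add_distrib, Finset.sum_range_sub, hE0]

theorem stepValue_le_cost (hm : m.Assumptions) (hP : m.IsCompoundPoisson P τ W)
    (hμ : m.IsPolicy μ) (hs : s ∈ Icc 0 m.cap) :
    m.stepValue (optimalValue hm) s ≤ m.cost P τ W μ s :=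
  sub_nonneg.1 (ge_of_tendsto' (hP.tendsto_sum_bellmanDefect hm hμ hs) fun _ =>
    Finset.sum_nonneg fun k _ => hP.integral_bellmanDefect_nonneg hm hμ hs k)

/-- Zero excess makes every nonnegative expected defect zero. The first one from level `0` already
forces the almost everywhere statement, and absolute continuity carries it back to all levels and
all later shocks. -/
theorem cost_eq_stepValue_iff (hm : m.Assumptions) (hP : m.IsCompoundPoisson P τ W)
    (hμ : m.IsPolicy μ) :
    (∀ s ∈ Icc 0 m.cap, m.cost P τ W μ s = m.stepValue (optimalValue hm) s) ↔
      ∀ᵐ p ∂m.stepLaw, bellmanDefect hm μ (m.fill 0 p.1) p.2 = 0 := by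
  obtain ⟨C, hC⟩ := exists_bound_bellmanDefect hm μ
  have hd := measurable_bellmanDefect hm hμ
  constructor
  · intro h
    have h0 : (0 : ℝ) ∈ Icc 0 m.cap := ⟨le_rfl, hm.cap_nonneg⟩
    have hlim := hP.tendsto_sum_bellmanDefect hm hμ h0
    rw [h 0 h0, sub_self] at hlim
    -- The first term is at most every nonempty partial sum, and these tend to `0`.
    have hfirst : m.stepValue (bellmanDefect hm μ) 0 ≤ 0 := by
      rw [← hP.integral_discountedReward_zero (τ := τ) (W := W) (μ := μ) hd]
      refine ge_of_tendsto hlim ?_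
      filter_upwards [eventually_ge_atTop 1] with n hn
      exact Finset.single_le_sum (f := fun k =>
          ∫ ω, m.discountedReward τ W μ 0 (bellmanDefect hm μ) k ω ∂P)
        (fun k _ => hP.integral_bellmanDefect_nonneg hm hμ h0 k) (Finset.mem_range.2 hn)
    have hnn : 0 ≤ᵐ[m.stepLaw] fun p : ℝ × ℝ =>
        Real.exp (-m.θ * p.1) * bellmanDefect hm μ (m.fill 0 p.1) p.2 := by
      filter_upwards [hm.ae_stepLaw] with p hp
      exact mul_nonneg (Real.exp_pos _).le
        (bellmanDefect_nonneg hm hμ (hm.fill_mem le_rfl hp.1.le) hp.2)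
    have hz := (integral_eq_zero_iff_of_nonneg_ae hnn (hm.integrable_step hd hC 0)).1
      (le_antisymm hfirst (integral_nonneg_of_ae hnn))
    filter_upwards [hz] with p hp
    exact (mul_eq_zero.1 hp).resolve_left (Real.exp_pos _).ne'
  · intro h s hs
    have hzero : ∀ k, ∫ ω, m.discountedReward τ W μ s (bellmanDefect hm μ) k ω ∂P = 0 := by
      rintro (_ | k)
      · rw [hP.integral_discountedReward_zero hd, hm.stepValue_eq_zero hs.1 h]
      -- Conditioned on the past, the next defect has expectation `stepValue` at a post-shock level,
      -- which is zero from every feasible level.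
      · rw [hP.integral_discountedReward_succ hm hμ hs hd hC]
        refine integral_eq_zero_of_ae ?_
        filter_upwards [hP.ae_level_mem hm hμ hs] with ω hω
        obtain ⟨h1, h2, -⟩ := hω k
        simp [discountedReward, hm.stepValue_eq_zero
          (sub_mem_of_mem_min h1 h2 (hμ.2 _ h1 _ h2)).1.1 h]
    have hlim := hP.tendsto_sum_bellmanDefect hm hμ hs
    simp only [hzero, Finset.sum_const_zero] at hlim
    exact (sub_eq_zero.1 (tendsto_nhds_unique hlim tendsto_const_nhds))

/-- Keeping the defect of the shock at time `0` on the left makes optimality at a single point `(s,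
w)` force zero defect at that very point. -/
theorem optimalValue_le_condCost (hm : m.Assumptions) (hP : m.IsCompoundPoisson P τ W)
    (hμ : m.IsPolicy μ) (hs : s ∈ Icc 0 m.cap) {w : ℝ} (hw : w ∈ Icc 0 m.B) :
    optimalValue hm s w + bellmanDefect hm μ s w ≤ m.condCost P τ W μ s w := by
  rw [bellmanDefect_eq hm hμ hs hw, add_sub_cancel]
  exact add_le_add_right
    (hP.stepValue_le_cost hm hμ (sub_mem_of_mem_min hs hw (hμ.2 s hs w hw)).1) _

/-- The extra shock tests the policy at each prescribed state, so no null set of exceptions remains,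
in contrast to `cost_eq_stepValue_iff`. -/
theorem condCost_eq_optimalValue_iff (hm : m.Assumptions) (hP : m.IsCompoundPoisson P τ W)
    (hμ : m.IsPolicy μ) :
    (∀ s ∈ Icc 0 m.cap, ∀ w ∈ Icc 0 m.B, m.condCost P τ W μ s w = optimalValue hm s w) ↔
      ∀ s ∈ Icc 0 m.cap, ∀ w ∈ Icc 0 m.B, bellmanDefect hm μ s w = 0 := by
  constructor
  · intro h s hs w hw
    have h1 := hP.optimalValue_le_condCost hm hμ hs hw
    rw [h s hs w hw] at h1
    exact le_antisymm (by linarith) (bellmanDefect_nonneg hm hμ hs hw)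
  · intro h s hs w hw
    have hcost := (hP.cost_eq_stepValue_iff hm hμ).2 (by
      filter_upwards [hm.ae_stepLaw] with p hp
      exact h _ (hm.fill_mem le_rfl hp.1.le) _ hp.2)
    have h0 := h s hs w hw
    rw [bellmanDefect_eq hm hμ hs hw, sub_eq_zero] at h0
    rw [← h0, condCost, hcost _ (sub_mem_of_mem_min hs hw (hμ.2 s hs w hw)).1]
    rfl

theorem isLeast_condCostValues (hm : m.Assumptions) (hP : m.IsCompoundPoisson P τ W)
    (hs : s ∈ Icc 0 m.cap) {w : ℝ} (hw : w ∈ Icc 0 m.B) :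
    IsLeast (m.condCostValues P τ W s w) (optimalValue hm s w) := by
  obtain ⟨μ, hμ, hgreedy⟩ := exists_greedy_policy hm
  refine ⟨⟨μ, hμ, ?_⟩, ?_⟩
  · refine ((hP.condCost_eq_optimalValue_iff hm hμ).2 (fun s hs w hw => ?_) s hs w hw).symm
    rw [bellmanDefect_eq hm hμ hs hw, sub_eq_zero]
    exact hgreedy s hs w hw
  · rintro _ ⟨μ', hμ', rfl⟩
    linarith [hP.optimalValue_le_condCost hm hμ' hs hw, bellmanDefect_nonneg hm hμ' hs hw]

theorem optCondCost_eq (hm : m.Assumptions) (hP : m.IsCompoundPoisson P τ W)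
    (hs : s ∈ Icc 0 m.cap) {w : ℝ} (hw : w ∈ Icc 0 m.B) :
    m.optCondCost P τ W s w = optimalValue hm s w :=
  (hP.isLeast_condCostValues hm hs hw).csInf_eq

theorem isMinOn_bellmanObjective_optCondCost_iff (hm : m.Assumptions)
    (hP : m.IsCompoundPoisson P τ W) (hμ : m.IsPolicy μ) (hs : s ∈ Icc 0 m.cap) {w : ℝ}
    (hw : w ∈ Icc 0 m.B) :
    IsMinOn (m.bellmanObjective (m.optCondCost P τ W) s w) (Icc 0 (min s w)) (μ s w) ↔
      bellmanDefect hm μ s w = 0 := by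
  rw [bellmanDefect_eq_zero_iff hm hμ hs hw, isMinOn_iff, isMinOn_iff]
  have h : ∀ u ∈ Icc 0 (min s w), m.bellmanObjective (m.optCondCost P τ W) s w u =
      m.bellmanObjective (optimalValue hm) s w u := fun u hu =>
    congrArg _ (hm.stepValue_congr (fun s hs w hw => hP.optCondCost_eq hm hs hw)
      (sub_mem_of_mem_min hs hw hu).1.1)
  rw [h _ (hμ.2 s hs w hw)]
  exact forall₂_congr fun u hu => by rw [h u hu]

theorem exists_cost_eq_stepValue (hm : m.Assumptions) (hP : m.IsCompoundPoisson P τ W) :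
    ∃ μ, m.IsPolicy μ ∧
      ∀ s ∈ Icc 0 m.cap, m.cost P τ W μ s = m.stepValue (optimalValue hm) s := by
  obtain ⟨μ, hμ, hgreedy⟩ := exists_greedy_policy hm
  refine ⟨μ, hμ, (hP.cost_eq_stepValue_iff hm hμ).2 ?_⟩
  filter_upwards [hm.ae_stepLaw] with p hp
  have h1 := hm.fill_mem (le_refl 0) hp.1.le
  rw [bellmanDefect_eq hm hμ h1 hp.2, sub_eq_zero]
  exact hgreedy _ h1 _ hp.2

end IsCompoundPoisson

end StorageModel

end

/-! ### Assembly of the theorem. -/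

theorem theorem1 (m : StorageModel) (hm : m.Assumptions)
    {Ω : Type*} [MeasurableSpace Ω] (P : Measure Ω) [IsProbabilityMeasure P]
    (τ W : ℕ → Ω → ℝ) (hP : m.IsCompoundPoisson P τ W) :
    -- the costs `C_μ(s)`, hence `J_μ(s, w)`, are well defined
    (∀ μ, m.IsPolicy μ → ∀ s ∈ Icc 0 m.cap,
      (∀ᵐ ω ∂P, Summable fun k => m.discountedStageCost τ W μ s k ω) ∧
      Integrable (fun ω => ∑' k, m.discountedStageCost τ W μ s k ω) P) ∧
    -- the minimum over the policies that defines `J*` is attained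
    (∀ s ∈ Icc 0 m.cap, ∀ w ∈ Icc 0 m.B,
      IsLeast (m.condCostValues P τ W s w) (m.optCondCost P τ W s w)) ∧
    -- the minimum that defines `T J` is attained, and `T` can be iterated
    (∀ J, m.HasExpectations J →
      (∀ s ∈ Icc 0 m.cap, ∀ w ∈ Icc 0 m.B,
        IsLeast (m.bellmanObjective J s w '' Icc 0 (min s w)) (m.bellman J s w)) ∧
      m.HasExpectations (m.bellman J)) ∧
    -- `J = J*` if and only if `J = T J`
    (∀ J : ℝ → ℝ → ℝ,
      (∀ s ∈ Icc 0 m.cap, ∀ w ∈ Icc 0 m.B, J s w = m.optCondCost P τ W s w) ↔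
      (m.HasExpectations J ∧
        ∀ s ∈ Icc 0 m.cap, ∀ w ∈ Icc 0 m.B, J s w = m.bellman J s w)) ∧
    -- a policy attains `J*` everywhere if and only if it attains the minimum in the Bellman equation
    (∀ μ, m.IsPolicy μ →
      ((∀ s ∈ Icc 0 m.cap, ∀ w ∈ Icc 0 m.B,
          ∀ μ', m.IsPolicy μ' → m.condCost P τ W μ s w ≤ m.condCost P τ W μ' s w) ↔
        ∀ s ∈ Icc 0 m.cap, ∀ w ∈ Icc 0 m.B,
          IsMinOn (m.bellmanObjective (m.optCondCost P τ W) s w) (Icc 0 (min s w)) (μ s w))) ∧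
    -- it minimizes `C_μ(s)` for all `s` if and only if it attains that minimum at almost all `(s, w)`
    (∀ μ, m.IsPolicy μ →
      ((∀ s ∈ Icc 0 m.cap, ∀ μ', m.IsPolicy μ' → m.cost P τ W μ s ≤ m.cost P τ W μ' s) ↔
        ∀ᵐ p ∂m.stepLaw,
          IsMinOn (m.bellmanObjective (m.optCondCost P τ W) (m.fill 0 p.1) p.2)
            (Icc 0 (min (m.fill 0 p.1) p.2)) (μ (m.fill 0 p.1) p.2))) ∧
    -- value iteration converges, uniformly on `[0, cap] × [0, B]`
    (∀ J₀, m.HasExpectations J₀ →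
      TendstoUniformlyOn (fun (k : ℕ) (p : ℝ × ℝ) => (m.bellman^[k] J₀) p.1 p.2)
        (fun p => m.optCondCost P τ W p.1 p.2) atTop (Icc 0 m.cap ×ˢ Icc 0 m.B)) := by
  
  refine ⟨fun μ hμ s hs => hP.summable_and_integrable_cost hm hμ hs, fun s hs w hw => ?_,
    fun J hJ => ⟨fun s hs w hw => hm.isLeast_bellman hJ hs hw, hm.hasExpectations_bellman hJ⟩,
    fun J => ⟨fun h => ?_, fun ⟨hJ, h⟩ s hs w hw => ?_⟩, fun μ hμ => ?_, fun μ hμ => ?_,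
    fun J₀ hJ₀ => ?_⟩
  · rw [hP.optCondCost_eq hm hs hw]
    exact hP.isLeast_condCostValues hm hs hw
  · have hV : ∀ s ∈ Icc 0 m.cap, ∀ w ∈ Icc 0 m.B, J s w = StorageModel.optimalValue hm s w :=
      fun s hs w hw => (h s hs w hw).trans (hP.optCondCost_eq hm hs hw)
    -- Regularity of `J*` is inherited from the bounded continuous fixed point, with which it agrees
    -- on the rectangle.
    refine ⟨hm.hasExpectations_congr (fun s hs w hw => (hV s hs w hw).symm)
      (StorageModel.hasExpectations_optimalValue hm), fun s hs w hw => ?_⟩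
    rw [hm.bellman_congr hV hs hw, hV s hs w hw]
    exact StorageModel.optimalValue_eq hm hs hw
  · rw [hP.optCondCost_eq hm hs hw]
    exact StorageModel.eq_bellmanFixedPoint hm hJ h hs hw
  · have hopt : (∀ s ∈ Icc 0 m.cap, ∀ w ∈ Icc 0 m.B,
        ∀ μ', m.IsPolicy μ' → m.condCost P τ W μ s w ≤ m.condCost P τ W μ' s w) ↔
        ∀ s ∈ Icc 0 m.cap, ∀ w ∈ Icc 0 m.B,
          m.condCost P τ W μ s w = StorageModel.optimalValue hm s w := by
      refine forall₂_congr fun s hs => forall₂_congr fun w hw => ?_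
      obtain ⟨⟨μ₀, hμ₀, h₀⟩, hlb⟩ := hP.isLeast_condCostValues hm hs hw
      refine ⟨fun h => le_antisymm ((h μ₀ hμ₀).trans h₀.ge) (hlb ⟨μ, hμ, rfl⟩),
        fun h μ' hμ' => ?_⟩
      rw [h]
      exact hlb ⟨μ', hμ', rfl⟩
    rw [hopt, hP.condCost_eq_optimalValue_iff hm hμ]
    exact forall₂_congr fun s hs => forall₂_congr fun w hw =>
      (hP.isMinOn_bellmanObjective_optCondCost_iff hm hμ hs hw).symm
  · have hopt : (∀ s ∈ Icc 0 m.cap, ∀ μ', m.IsPolicy μ' →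
        m.cost P τ W μ s ≤ m.cost P τ W μ' s) ↔
        ∀ s ∈ Icc 0 m.cap, m.cost P τ W μ s =
          m.stepValue (StorageModel.optimalValue hm) s := by
      -- A single policy attains the lower bound at all levels at once, so being optimal at a level
      -- means attaining that bound there.
      obtain ⟨μ₀, hμ₀, h₀⟩ := hP.exists_cost_eq_stepValue hm
      refine forall₂_congr fun s hs => ⟨fun h => ?_, fun h μ' hμ' => ?_⟩
      · exact le_antisymm ((h μ₀ hμ₀).trans (h₀ s hs).le) (hP.stepValue_le_cost hm hμ hs)
      · rw [h]
        exact hP.stepValue_le_cost hm hμ' hs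
    rw [hopt, hP.cost_eq_stepValue_iff hm hμ]
    refine eventually_congr ?_
    filter_upwards [hm.ae_stepLaw] with p hp
    exact (hP.isMinOn_bellmanObjective_optCondCost_iff hm hμ (hm.fill_mem le_rfl hp.1.le)
      hp.2).symm
  · exact (StorageModel.tendstoUniformlyOn_bellman_iterate hm hJ₀).congr_right
      fun p hp => (hP.optCondCost_eq hm hp.1 hp.2).symm
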